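/- Work over the field $\mathbf{C}$ of complex numbers. Let $d \geq 4$ be an integer, let $$v_d \colon \mathbf{P}^1 \longrightarrow \mathbf{P}^d, \qquad [u:v] \longmapsto [u^d : u^{d-1}v : \cdots : uv^{d-1} : v^d]$$ be the Veronese embedding, let $C := v_d(\mathbf{P}^1) \subseteq \mathbf{P}^d$ be the rational normal curve of degree $d$, and let $\Sigma \subseteq \mathbf{P}^d$ be its first secant variety, that is, the Zariski closure of the union of the lines through two distinct points of $C$. For a variety $X$, let $\operatorname{Aut}(X)$ be the group of automorphisms of $X$ as a variety over $\mathbf{C}$. Then $$\operatorname{Aut}(\Sigma) \cong \operatorname{Aut}(\mathbf{P}^1) = \operatorname{PGL}(2, \mathbf{C}).$$ More precisely: the singular locus of $\Sigma$ is $C$; every automorphism of $\Sigma$ maps $C$ to itself, and restriction to $C$, $$\operatorname{Aut}(\Sigma) \longrightarrow \operatorname{Aut}(C), \qquad \varphi \longmapsto \varphi|_C,$$ is an isomorphism of groups; $v_d$ induces an isomorphism of groups $\operatorname{Aut}(\mathbf{P}^1) \cong \operatorname{Aut}(C)$, $\psi \mapsto v_d \circ \psi \circ v_d^{-1}$; and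 the usual action of $\operatorname{PGL}(2, \mathbf{C})$ on $\mathbf{P}^1$ gives an isomorphism of groups $\operatorname{PGL}(2, \mathbf{C}) \cong \operatorname{Aut}(\mathbf{P}^1)$. -/

import Mathlib

open scoped LinearAlgebra.Projectivization

noncomputable section

/-! Classical projective geometry over `ℂ`.  Points of a projective space are the elements of
`ℙ ℂ (ι → ℂ)`, and a variety is the set of its (closed) points. -/

namespace ProjVar

variable {ι κ τ : Type*}

/-- The punctured affine cone over a set of points of projective space. -/
def cone (X : Set (ℙ ℂ (ι → ℂ))) : Set (ι → ℂ) :=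
  {v | ∃ hv : v ≠ 0, Projectivization.mk ℂ v hv ∈ X}

/-- The homogeneous ideal `I(X)` of all polynomials that vanish on `X` (equivalently, on the
cone over `X`). -/
def ideal (X : Set (ℙ ℂ (ι → ℂ))) : Ideal (MvPolynomial ι ℂ) :=
  MvPolynomial.vanishingIdeal ℂ (cone X)

/-- The Zariski closure in projective space: the common zeros of `I(X)`. -/
def zariskiClosure (X : Set (ℙ ℂ (ι → ℂ))) : Set (ℙ ℂ (ι → ℂ)) :=
  {p | ∀ F ∈ ideal X, MvPolynomial.eval p.rep F = 0}

/-- A map `f : X → Y` between subsets of projective spaces is regular if around every point it is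
given by homogeneous polynomials of one and the same degree.  The neighbourhood is taken to be the
whole set of points of `X` where these polynomials do not vanish simultaneously; this is no
restriction, because if the formula only holds on a smaller neighbourhood `X ∩ {G ≠ 0}`, one may
multiply all the polynomials by the form `G`. -/
def IsRegularMap {X : Set (ℙ ℂ (ι → ℂ))} {Y : Set (ℙ ℂ (κ → ℂ))} (f : X → Y) : Prop :=
  ∀ x : X, ∃ (k : ℕ) (F : κ → MvPolynomial ι ℂ), (∀ j, (F j).IsHomogeneous k) ∧
    (fun j => MvPolynomial.eval x.1.rep (F j)) ≠ 0 ∧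
    ∀ (y : X) (hy : (fun j => MvPolynomial.eval y.1.rep (F j)) ≠ 0),
      (f y).1 = Projectivization.mk ℂ (fun j => MvPolynomial.eval y.1.rep (F j)) hy

theorem isRegularMap_id (X : Set (ℙ ℂ (ι → ℂ))) : IsRegularMap (id : X → X) := by
  intro x
  refine ⟨1, MvPolynomial.X, fun j => MvPolynomial.isHomogeneous_X ℂ j, ?_, ?_⟩
  · simpa using x.1.rep_nonzero
  · intro y hy
    simp

/-- Homogeneous polynomials scale by a power. -/
theorem eval_smul_of_isHomogeneous {l : ℕ} {G : MvPolynomial κ ℂ} (hG : G.IsHomogeneous l)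
    (a : ℂ) (v : κ → ℂ) :
    MvPolynomial.eval (a • v) G = a ^ l * MvPolynomial.eval v G := by
  rw [MvPolynomial.eval_eq, MvPolynomial.eval_eq, Finset.mul_sum]
  refine Finset.sum_congr rfl fun e he => ?_
  have hdeg : ∑ i ∈ e.support, e i = l := by
    have h := hG (MvPolynomial.mem_support_iff.mp he)
    rw [Finsupp.weight_apply] at h
    simpa [Finsupp.sum] using h
  simp only [Pi.smul_apply, smul_eq_mul, mul_pow, Finset.prod_mul_distrib, Finset.prod_pow_eq_pow_sum,
    hdeg]
  ring

theorem IsRegularMap.comp {X : Set (ℙ ℂ (ι → ℂ))} {Y : Set (ℙ ℂ (κ → ℂ))}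
    {Z : Set (ℙ ℂ (τ → ℂ))} {g : Y → Z} {f : X → Y}
    (hg : IsRegularMap g) (hf : IsRegularMap f) : IsRegularMap (g ∘ f) := by
  intro x
  obtain ⟨k, F, hF, hFx, hFf⟩ := hf x
  obtain ⟨l, G, hG, hGx, hGg⟩ := hg (f x)
  obtain ⟨i, hi⟩ := Function.ne_iff.mp hFx
  have key : ∀ y : X, (fun j => MvPolynomial.eval y.1.rep (F j)) ≠ 0 → ∃ a : ℂ, a ≠ 0 ∧
      ∀ j, MvPolynomial.eval y.1.rep (MvPolynomial.aeval F (G j)) =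
        a * MvPolynomial.eval (f y).1.rep (G j) := by
    intro y hy
    have h1 := hFf y hy
    rw [← Projectivization.mk_rep (f y).1, Projectivization.mk_eq_mk_iff'] at h1
    obtain ⟨a, ha⟩ := h1
    have ha0 : a ≠ 0 := by
      rintro rfl
      exact (f y).1.rep_nonzero (by rw [← ha, zero_smul])
    refine ⟨a⁻¹ ^ l, pow_ne_zero _ (inv_ne_zero ha0), fun j => ?_⟩
    rw [← eval_smul_of_isHomogeneous (hG j), ← ha, inv_smul_smul₀ ha0, MvPolynomial.aeval_eq_bind₁]
    exact MvPolynomial.eval₂Hom_bind₁ _ _ _ _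
  refine ⟨k + k * l, fun j => F i * MvPolynomial.aeval F (G j),
    fun j => (hF i).mul ((hG j).aeval F hF), ?_, ?_⟩
  · obtain ⟨a, ha, h⟩ := key x hFx
    obtain ⟨j, hj⟩ := Function.ne_iff.mp hGx
    refine Function.ne_iff.mpr ⟨j, ?_⟩
    simp only [map_mul, h j]
    exact mul_ne_zero hi (mul_ne_zero ha hj)
  · intro y hy
    have hFi : MvPolynomial.eval y.1.rep (F i) ≠ 0 := by
      intro h0
      exact hy (by funext j; simp [h0])
    obtain ⟨a, ha, h⟩ := key y (Function.ne_iff.mpr ⟨i, hFi⟩)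
    have hGy : (fun j => MvPolynomial.eval (f y).1.rep (G j)) ≠ 0 := by
      intro h0
      apply hy
      funext j
      have h0j : MvPolynomial.eval (f y).1.rep (G j) = 0 := congrFun h0 j
      change MvPolynomial.eval y.1.rep (F i * MvPolynomial.aeval F (G j)) = 0
      rw [map_mul, h j, h0j, mul_zero, mul_zero]
    rw [Function.comp_apply, hGg (f y) hGy, Projectivization.mk_eq_mk_iff']
    refine ⟨(MvPolynomial.eval y.1.rep (F i) * a)⁻¹, ?_⟩
    funext j
    simp only [Pi.smul_apply, smul_eq_mul, map_mul, h j]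
    field_simp

/-- The group `Aut X` of automorphisms of a variety: bijections that are regular together with
their inverses. -/
def Aut (X : Set (ℙ ℂ (ι → ℂ))) : Subgroup (Equiv.Perm X) where
  carrier := {φ | IsRegularMap φ ∧ IsRegularMap φ.symm}
  mul_mem' := fun ha hb => ⟨ha.1.comp hb.1, hb.2.comp ha.2⟩
  one_mem' := ⟨isRegularMap_id X, isRegularMap_id X⟩
  inv_mem' := fun ha => ⟨ha.2, ha.1⟩

/-- The Zariski tangent space to the affine cone over `X` at a representative of `p`.  For `p ∈ X`
its dimension is one more than that of the Zariski tangent space to `X` at `p`. -/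
def coneTangentSpace [Fintype ι] (X : Set (ℙ ℂ (ι → ℂ))) (p : ℙ ℂ (ι → ℂ)) : Submodule ℂ (ι → ℂ) where
  carrier := {w | ∀ F ∈ ideal X, ∑ i, MvPolynomial.eval p.rep (MvPolynomial.pderiv i F) * w i = 0}
  zero_mem' := by intro F _; simp
  add_mem' := by
    intro v w hv hw F hF
    simp [mul_add, Finset.sum_add_distrib, hv F hF, hw F hF]
  smul_mem' := by
    intro a w hw F hF
    simp [mul_left_comm _ a, ← Finset.mul_sum, hw F hF]

/-- The singular locus of an irreducible projective variety `X`: the points where the tangent space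
is larger than `dim X`.  Both sides of the inequality are those of the affine cone over `X`: its
dimension `dim X + 1` is the transcendence degree of the homogeneous coordinate ring. -/
def singularLocus [Fintype ι] (X : Set (ℙ ℂ (ι → ℂ))) : Set (ℙ ℂ (ι → ℂ)) :=
  {p | p ∈ X ∧ Algebra.trdeg ℂ (MvPolynomial ι ℂ ⧸ ideal X) <
    (Module.finrank ℂ (coneTangentSpace X p) : Cardinal)}

/-- The Veronese map `[u : v] ↦ [u ^ d : u ^ (d - 1) * v : ⋯ : v ^ d]`. -/
def veronese (d : ℕ) (p : ℙ ℂ (Fin 2 → ℂ)) : ℙ ℂ (Fin (d + 1) → ℂ) :=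
  Projectivization.mk ℂ (fun i => p.rep 0 ^ (d - (i : ℕ)) * p.rep 1 ^ (i : ℕ)) (by
    intro h
    have h0 := congrFun h 0
    have h1 := congrFun h (Fin.last d)
    simp only [Fin.val_zero, Nat.sub_zero, pow_zero, mul_one, Pi.zero_apply, Fin.val_last,
      Nat.sub_self, one_mul] at h0 h1
    apply p.rep_nonzero
    funext i
    fin_cases i
    · exact eq_zero_of_pow_eq_zero h0
    · exact eq_zero_of_pow_eq_zero h1)

/-- The rational normal curve of degree `d` in projective `d`-space. -/
def rationalNormalCurve (d : ℕ) : Set (ℙ ℂ (Fin (d + 1) → ℂ)) :=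
  Set.range (veronese d)

/-- The line through two (distinct) points. -/
def line (p q : ℙ ℂ (ι → ℂ)) : Set (ℙ ℂ (ι → ℂ)) :=
  {r | r.submodule ≤ p.submodule ⊔ q.submodule}

/-- The first secant variety of the rational normal curve `C` of degree `d`: the Zariski closure of
the union of the lines through two distinct points of `C`. -/
def secantVariety (d : ℕ) : Set (ℙ ℂ (Fin (d + 1) → ℂ)) :=
  zariskiClosure
    (⋃ (p ∈ rationalNormalCurve d) (q ∈ rationalNormalCurve d) (_ : p ≠ q), line p q)

/-- The projective line, as a variety. -/
def projectiveLine : Set (ℙ ℂ (Fin 2 → ℂ)) := Set.univ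

end ProjVar

end

/-! Write p(v) for the vector of degree d monomials in v ∈ ℂ². Since scalars have d-th roots, the
vectors p(a) + p(b) sweep out the cone over the secant lines, so a polynomial lies in I(Σ) iff it
vanishes at all of them (`mem_ideal_secantVariety_iff_eval`).

Singular locus. The cone over Σ has dimension 4 (`trdeg_secantVariety`). At p(v) the lines p(v) + t
p(w) lie in the cone and the p(w) span, so the tangent space is all of ℂ^(d+1), which is too large
for d ≥ 4. Off C, the three-column Hankel matrix of x has two independent rows, with cross product
q. Differentiating its minors shows that tangent vectors satisfy a linear recurrence with
characteristic polynomial q(T)², so they form a space of dimension at most 4. Isomorphisms preserve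
tangent dimensions (`finrank_coneTangentSpace_le`), hence automorphisms preserve C.

Injectivity. By unique factorization, a regular map composed with (a, b) ↦ p(a) + p(b) is given by
one primitive tuple G, unique up to a constant. Uniqueness makes G an eigenvector of every rescaling
that preserves the parametrization projectively. If the map fixes C pointwise, G is c p(a) on b = 0
and c' p(b) on a = 0. Scaling by 2 makes G homogeneous of degree d, and scaling a alone by a
primitive d-th root of unity excludes mixed monomials. Thus G = c p(a) + c' p(b), and c = c' because
G has no zeros where the parametrization has none. The map is the identity on secant lines, hence on
their closure (`eq_self_of_fixes_curve`).

Surjectivity. Uniqueness of primitive tuples also shows that automorphisms of the line are linear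
(`exists_matrix_of_mem_aut`); automorphisms of C therefore come from matrices, and these act
linearly on degree d forms, preserving Σ (`exists_aut_secantVariety`). -/

open scoped LinearAlgebra.Projectivization

noncomputable section

/-! ### Representatives of points and regular maps -/

namespace ProjVar

open MvPolynomial

variable {ι κ τ : Type*}

/-- The polynomial map given by a tuple of polynomials. -/
def polyMap (F : κ → MvPolynomial ι ℂ) (v : ι → ℂ) : κ → ℂ := fun j => eval v (F j)

@[simp] theorem polyMap_apply (F : κ → MvPolynomial ι ℂ) (v : ι → ℂ) (j : κ) :
    polyMap F v j = eval v (F j) := rfl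

theorem polyMap_smul {F : κ → MvPolynomial ι ℂ} {k : ℕ} (hF : ∀ j, (F j).IsHomogeneous k)
    (a : ℂ) (v : ι → ℂ) : polyMap F (a • v) = a ^ k • polyMap F v := by
  funext j
  simp [eval_smul_of_isHomogeneous (hF j)]

theorem mk_smul {a : ℂ} {v : ι → ℂ} (hav : a • v ≠ 0) (hv : v ≠ 0) :
    Projectivization.mk ℂ (a • v) hav = Projectivization.mk ℂ v hv :=
  (Projectivization.mk_eq_mk_iff' ℂ _ _ _ _).2 ⟨a, rfl⟩

theorem mk_congr {v w : ι → ℂ} (h : v = w) (hv : v ≠ 0) (hw : w ≠ 0) :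
    Projectivization.mk ℂ v hv = Projectivization.mk ℂ w hw := by
  subst h; rfl

theorem exists_rep_eq_smul (v : ι → ℂ) (hv : v ≠ 0) :
    ∃ a : ℂ, a ≠ 0 ∧ (Projectivization.mk ℂ v hv).rep = a • v := by
  obtain ⟨a, ha⟩ := Projectivization.exists_smul_eq_mk_rep ℂ v hv
  exact ⟨a, a.ne_zero, ha.symm⟩

/-- Vectors span the same line when their coordinates are proportional. -/
theorem mk_eq_mk_of_mul_eq {v w : ι → ℂ} (hv : v ≠ 0) (hw : w ≠ 0)
    (h : ∀ i j, v i * w j = v j * w i) :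
    Projectivization.mk ℂ v hv = Projectivization.mk ℂ w hw := by
  obtain ⟨i, hi⟩ := Function.ne_iff.mp hw
  refine (Projectivization.mk_eq_mk_iff' ℂ _ _ _ _).2 ⟨v i / w i, ?_⟩
  have hi' : w i ≠ 0 := hi
  funext j
  simp only [Pi.smul_apply, smul_eq_mul]
  field_simp
  rw [h i j, mul_comm]

theorem mul_eq_of_mk_eq_mk {v w : ι → ℂ} {hv : v ≠ 0} {hw : w ≠ 0}
    (h : Projectivization.mk ℂ v hv = Projectivization.mk ℂ w hw) (i j : ι) :
    v i * w j = v j * w i := by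
  obtain ⟨a, rfl⟩ := (Projectivization.mk_eq_mk_iff' ℂ _ _ _ _).1 h
  simp only [Pi.smul_apply, smul_eq_mul]
  ring

theorem mem_ideal_iff {X : Set (ℙ ℂ (ι → ℂ))} {F : MvPolynomial ι ℂ} :
    F ∈ ideal X ↔ ∀ (v : ι → ℂ) (hv : v ≠ 0), Projectivization.mk ℂ v hv ∈ X → eval v F = 0 := by
  constructor
  · intro h v hv hX
    exact h v ⟨hv, hX⟩
  · rintro h v ⟨hv, hX⟩
    exact h v hv hX

theorem subset_zariskiClosure (X : Set (ℙ ℂ (ι → ℂ))) : X ⊆ zariskiClosure X := by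
  intro p hp F hF
  exact mem_ideal_iff.1 hF _ p.rep_nonzero (by rwa [Projectivization.mk_rep])

/-- Regularity in terms of arbitrary representatives; the forms may be taken of positive degree. -/
theorem IsRegularMap.exists_polyMap {X : Set (ℙ ℂ (ι → ℂ))} {Y : Set (ℙ ℂ (κ → ℂ))} {f : X → Y}
    (hf : IsRegularMap f) (v : ι → ℂ) (hv : v ≠ 0) (hX : Projectivization.mk ℂ v hv ∈ X) :
    ∃ (k : ℕ) (F : κ → MvPolynomial ι ℂ), 0 < k ∧ (∀ j, (F j).IsHomogeneous k) ∧
      polyMap F v ≠ 0 ∧ ∀ (w : ι → ℂ) (hw : w ≠ 0) (hwX : Projectivization.mk ℂ w hw ∈ X)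
        (h : polyMap F w ≠ 0),
        (f ⟨Projectivization.mk ℂ w hw, hwX⟩).1 = Projectivization.mk ℂ (polyMap F w) h := by
  obtain ⟨k, F, hF, hne, h⟩ := hf ⟨_, hX⟩
  obtain ⟨i, hi⟩ := Function.ne_iff.mp hv
  have hi' : v i ≠ 0 := hi
  -- Multiplying by a coordinate that is nonzero at `v` makes the degree positive, as Euler's
  -- identity will require.
  refine ⟨1 + k, fun j => MvPolynomial.X i * F j, by omega, fun j => (isHomogeneous_X ℂ i).mul (hF j), ?_, ?_⟩
  · obtain ⟨j, hj⟩ := Function.ne_iff.mp hne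
    obtain ⟨a, ha, hav⟩ := exists_rep_eq_smul v hv
    refine Function.ne_iff.mpr ⟨j, ?_⟩
    simp only [hav, eval_smul_of_isHomogeneous (hF j)] at hj
    simp only [polyMap_apply, map_mul, eval_X]
    exact mul_ne_zero hi' (right_ne_zero_of_mul hj)
  · intro w hw hwX hne'
    obtain ⟨a, ha, hav⟩ := exists_rep_eq_smul w hw
    obtain ⟨j, hj⟩ := Function.ne_iff.mp hne'
    simp only [polyMap_apply, map_mul, eval_X, Pi.zero_apply] at hj
    have hne2 : polyMap F ((Projectivization.mk ℂ w hw).rep) ≠ 0 := by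
      rw [hav, polyMap_smul hF]
      refine smul_ne_zero (pow_ne_zero _ ha) (Function.ne_iff.mpr ⟨j, right_ne_zero_of_mul hj⟩)
    rw [h ⟨_, hwX⟩ hne2]
    refine (Projectivization.mk_eq_mk_iff' ℂ _ _ _ _).2 ⟨a ^ k / w i, ?_⟩
    change _ = polyMap F (Projectivization.mk ℂ w hw).rep
    rw [hav, polyMap_smul hF]
    funext l
    have := left_ne_zero_of_mul hj
    simp
    field_simp

theorem isRegularMap_of_polyMap {X : Set (ℙ ℂ (ι → ℂ))} {Y : Set (ℙ ℂ (κ → ℂ))} {f : X → Y}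
    (h : ∀ (v : ι → ℂ) (hv : v ≠ 0) (_ : Projectivization.mk ℂ v hv ∈ X),
      ∃ (k : ℕ) (F : κ → MvPolynomial ι ℂ), (∀ j, (F j).IsHomogeneous k) ∧
      polyMap F v ≠ 0 ∧ ∀ (w : ι → ℂ) (hw : w ≠ 0) (hwX : Projectivization.mk ℂ w hw ∈ X)
        (h : polyMap F w ≠ 0),
        (f ⟨Projectivization.mk ℂ w hw, hwX⟩).1 = Projectivization.mk ℂ (polyMap F w) h) :
    IsRegularMap f := by
  rintro ⟨x, hx⟩
  obtain ⟨k, F, hF, hne, hf⟩ := h x.rep x.rep_nonzero (by rwa [Projectivization.mk_rep])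
  refine ⟨k, F, hF, hne, ?_⟩
  rintro ⟨y, hy⟩ hney
  refine Eq.trans ?_ (hf y.rep y.rep_nonzero (by rwa [Projectivization.mk_rep]) hney)
  simp only [Projectivization.mk_rep]

theorem IsRegularMap.restrict {X X' : Set (ℙ ℂ (ι → ℂ))} {Y Y' : Set (ℙ ℂ (κ → ℂ))} {f : X → Y}
    (hf : IsRegularMap f) (hX : X' ⊆ X) {g : X' → Y'}
    (hg : ∀ x : X', (g x).1 = (f ⟨x.1, hX x.2⟩).1) : IsRegularMap g := by
  intro x
  obtain ⟨k, F, hF, hne, h⟩ := hf ⟨x.1, hX x.2⟩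
  exact ⟨k, F, hF, hne, fun y hy => (hg y).trans (h ⟨y.1, hX y.2⟩ hy)⟩

end ProjVar

/-! ### Primitive tuples and lifts of regular maps along parametrizations -/

namespace ProjVar

open MvPolynomial

variable {ι κ σ : Type*}

/-- A tuple of polynomials without common factor. -/
def IsPrimitiveTuple (G : κ → MvPolynomial σ ℂ) : Prop := ∀ g, (∀ j, g ∣ G j) → IsUnit g

/-- The tuple `G` describes the composite of `f` with the polynomial map `Ψ`, at all points where
the latter is defined. -/
def Represents {X : Set (ℙ ℂ (ι → ℂ))} {Y : Set (ℙ ℂ (κ → ℂ))} (f : X → Y)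
    (Ψ : ι → MvPolynomial σ ℂ) (G : κ → MvPolynomial σ ℂ) : Prop :=
  ∀ (z : σ → ℂ) (hz : polyMap Ψ z ≠ 0) (hX : Projectivization.mk ℂ (polyMap Ψ z) hz ∈ X),
    ∃ hG : polyMap G z ≠ 0, (f ⟨_, hX⟩).1 = Projectivization.mk ℂ (polyMap G z) hG

theorem exists_primitive_factor [Fintype κ] (G : κ → MvPolynomial σ ℂ) (hG : ∃ j, G j ≠ 0) :
    ∃ (g : MvPolynomial σ ℂ) (G' : κ → MvPolynomial σ ℂ), g ≠ 0 ∧ (∀ j, G j = g * G' j) ∧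
      IsPrimitiveTuple G' := by
  classical
  let _ : StrongNormalizationMonoid (MvPolynomial σ ℂ) :=
    UniqueFactorizationMonoid.strongNormalizationMonoid
  let _ : StrongNormalizedGCDMonoid (MvPolynomial σ ℂ) :=
    UniqueFactorizationMonoid.toStrongNormalizedGCDMonoid _
  obtain ⟨j, hj⟩ := hG
  obtain ⟨G', h, h1⟩ := Finset.extract_gcd (s := Finset.univ) G ⟨j, Finset.mem_univ j⟩
  refine ⟨Finset.univ.gcd G, G', ?_, fun j => h j (Finset.mem_univ j), ?_⟩
  · intro h0
    exact hj (Finset.gcd_eq_zero_iff.1 h0 j (Finset.mem_univ j))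
  · intro g hg
    rw [isUnit_iff_dvd_one, ← h1]
    exact Finset.dvd_gcd fun b _ => hg b

theorem IsPrimitiveTuple.exists_ne_zero {G : κ → MvPolynomial σ ℂ} (hG : IsPrimitiveTuple G) :
    ∃ j, G j ≠ 0 := by
  by_contra! h
  exact not_isUnit_zero (hG 0 fun j => by rw [h j])

/-- `G i` divides every `G j * G' i`, hence their gcd, which is `G' i` up to a unit because the `G
j` have gcd 1. The quotient is the factor sought. -/
theorem IsPrimitiveTuple.exists_eq_mul [Fintype κ] {G G' : κ → MvPolynomial σ ℂ}
    (hG : IsPrimitiveTuple G) (h : ∀ i j, G i * G' j = G j * G' i) :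
    ∃ p : MvPolynomial σ ℂ, ∀ j, G' j = p * G j := by
  classical
  let _ : StrongNormalizationMonoid (MvPolynomial σ ℂ) :=
    UniqueFactorizationMonoid.strongNormalizationMonoid
  let _ : StrongNormalizedGCDMonoid (MvPolynomial σ ℂ) :=
    UniqueFactorizationMonoid.toStrongNormalizedGCDMonoid _
  obtain ⟨i, hi⟩ := hG.exists_ne_zero
  have hdvd : G i ∣ G' i := by
    have h1 : G i ∣ Finset.univ.gcd (fun j => G j * G' i) :=
      Finset.dvd_gcd fun j _ => ⟨G' j, (h i j).symm⟩
    have h2 := h1.trans (Finset.gcd_mul_right' (s := Finset.univ) (f := G) (G' i)).dvd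
    have h3 : IsUnit (Finset.univ.gcd G) :=
      hG _ fun j => Finset.gcd_dvd (Finset.mem_univ j)
    exact (h3.dvd_mul_left).1 h2
  obtain ⟨p, hp⟩ := hdvd
  refine ⟨p, fun j => mul_left_cancel₀ hi ?_⟩
  rw [h i j, hp]
  ring

/-- The proportionality factor is a common divisor of `G'`, so it is a unit, that is, a nonzero
constant. This uniqueness turns symmetries of a map into symmetries of its tuple. -/
theorem IsPrimitiveTuple.exists_eq_C_mul [Fintype κ] {G G' : κ → MvPolynomial σ ℂ}
    (hG : IsPrimitiveTuple G) (hG' : IsPrimitiveTuple G') (h : ∀ i j, G i * G' j = G j * G' i) :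
    ∃ c : ℂ, c ≠ 0 ∧ ∀ j, G' j = C c * G j := by
  obtain ⟨p, hp⟩ := hG.exists_eq_mul h
  obtain ⟨hu, h0⟩ := isUnit_iff_totalDegree_of_isReduced.1 (hG' p fun j => ⟨G j, hp j⟩)
  refine ⟨p.coeff 0, hu.ne_zero, fun j => ?_⟩
  rw [← totalDegree_eq_zero_iff_eq_C.1 h0]
  exact hp j

/-- A polynomial identity that holds where some polynomial map does not vanish holds
everywhere. -/
theorem eq_of_eval_eq_of_polyMap_ne_zero {Ψ : ι → MvPolynomial σ ℂ} (hΨ : ∃ z, polyMap Ψ z ≠ 0)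
    {P Q : MvPolynomial σ ℂ} (h : ∀ z, polyMap Ψ z ≠ 0 → eval z P = eval z Q) : P = Q := by
  obtain ⟨z, hz⟩ := hΨ
  obtain ⟨l, hl⟩ := Function.ne_iff.mp hz
  have hl' : Ψ l ≠ 0 := by
    rintro h0
    simp [h0] at hl
  -- After multiplication by a nonzero component of `Ψ`, the two sides agree at every point.
  refine mul_left_cancel₀ hl' (MvPolynomial.funext fun w => ?_)
  rw [map_mul, map_mul]
  by_cases hw : polyMap Ψ w = 0
  · have := congrFun hw l
    simp only [polyMap_apply, Pi.zero_apply] at this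
    rw [this, zero_mul, zero_mul]
  · rw [h w hw]

theorem Represents.mul_eq {X : Set (ℙ ℂ (ι → ℂ))} {Y : Set (ℙ ℂ (κ → ℂ))} {f : X → Y}
    {Ψ : ι → MvPolynomial σ ℂ} (hΨ : ∃ z, polyMap Ψ z ≠ 0)
    (hΨX : ∀ z (hz : polyMap Ψ z ≠ 0), Projectivization.mk ℂ (polyMap Ψ z) hz ∈ X)
    {G G' : κ → MvPolynomial σ ℂ} (hG : Represents f Ψ G) (hG' : Represents f Ψ G') (i j : κ) :
    G i * G' j = G j * G' i := by
  refine eq_of_eval_eq_of_polyMap_ne_zero hΨ fun z hz => ?_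
  obtain ⟨h1, h2⟩ := hG z hz (hΨX z hz)
  obtain ⟨h3, h4⟩ := hG' z hz (hΨX z hz)
  simpa using mul_eq_of_mk_eq_mk (h2.symm.trans h4) i j

theorem Represents.exists_eq_C_mul [Fintype κ] {X : Set (ℙ ℂ (ι → ℂ))} {Y : Set (ℙ ℂ (κ → ℂ))}
    {f : X → Y} {Ψ : ι → MvPolynomial σ ℂ} (hΨ : ∃ z, polyMap Ψ z ≠ 0)
    (hΨX : ∀ z (hz : polyMap Ψ z ≠ 0), Projectivization.mk ℂ (polyMap Ψ z) hz ∈ X)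
    {G G' : κ → MvPolynomial σ ℂ} (hG : Represents f Ψ G) (hG' : Represents f Ψ G')
    (hp : IsPrimitiveTuple G) (hp' : IsPrimitiveTuple G') :
    ∃ c : ℂ, c ≠ 0 ∧ ∀ j, G' j = C c * G j :=
  hp.exists_eq_C_mul hp' (hG.mul_eq hΨ hΨX hG')

theorem eval_bind₁ (Ψ : ι → MvPolynomial σ ℂ) (z : σ → ℂ) (P : MvPolynomial ι ℂ) :
    eval z (bind₁ Ψ P) = eval (polyMap Ψ z) P :=
  eval₂Hom_bind₁ _ _ _ _

theorem polyMap_bind₁ (Ψ : ι → MvPolynomial σ ℂ) (F : κ → MvPolynomial ι ℂ) (z : σ → ℂ) :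
    polyMap (fun j => bind₁ Ψ (F j)) z = polyMap F (polyMap Ψ z) := by
  funext j
  exact eval_bind₁ Ψ z (F j)

/-- A regular map, composed with a polynomial map, is given by one tuple of polynomials. -/
theorem IsRegularMap.exists_represents [Fintype κ] {X : Set (ℙ ℂ (ι → ℂ))}
    {Y : Set (ℙ ℂ (κ → ℂ))} {f : X → Y} (hf : IsRegularMap f) {Ψ : ι → MvPolynomial σ ℂ}
    (hΨ : ∃ z, polyMap Ψ z ≠ 0)
    (hΨX : ∀ z (hz : polyMap Ψ z ≠ 0), Projectivization.mk ℂ (polyMap Ψ z) hz ∈ X) :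
    ∃ G : κ → MvPolynomial σ ℂ, IsPrimitiveTuple G ∧ Represents f Ψ G := by
  obtain ⟨z₀, hz₀⟩ := hΨ
  obtain ⟨k, F, -, -, hFz, hFf⟩ := hf.exists_polyMap _ hz₀ (hΨX z₀ hz₀)
  obtain ⟨j₀, hj₀⟩ := Function.ne_iff.mp hFz
  obtain ⟨g, G, hg, hgG, hG⟩ := exists_primitive_factor (fun j => bind₁ Ψ (F j)) ⟨j₀, by
    intro h0
    have h0' : bind₁ Ψ (F j₀) = 0 := h0
    apply hj₀
    rw [polyMap_apply, ← eval_bind₁, h0', map_zero, Pi.zero_apply]⟩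
  refine ⟨G, hG, ?_⟩
  intro z hz hX
  obtain ⟨k', F', -, -, hFz', hFf'⟩ := hf.exists_polyMap _ hz (hΨX z hz)
  -- The formula near `z` and the one near `z₀` compute the same map where both apply, so as
  -- polynomial tuples they are proportional. Primitivity of `G` gives `F' ∘ Ψ = p G`, and as the
  -- left side is nonzero at `z`, so is `G`.
  have key : ∀ i j, G i * bind₁ Ψ (F' j) = G j * bind₁ Ψ (F' i) := by
    intro i j
    refine mul_left_cancel₀ hg ?_
    rw [← mul_assoc, ← mul_assoc, ← hgG, ← hgG]
    refine eq_of_eval_eq_of_polyMap_ne_zero ⟨z₀, hz₀⟩ fun w hw => ?_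
    simp only [map_mul, eval_bind₁]
    by_cases h1 : polyMap F (polyMap Ψ w) = 0
    · have hi := congrFun h1 i
      have hj := congrFun h1 j
      simp only [polyMap_apply, Pi.zero_apply] at hi hj
      rw [hi, hj, zero_mul, zero_mul]
    by_cases h2 : polyMap F' (polyMap Ψ w) = 0
    · have hi := congrFun h2 i
      have hj := congrFun h2 j
      simp only [polyMap_apply, Pi.zero_apply] at hi hj
      rw [hi, hj, mul_zero, mul_zero]
    exact mul_eq_of_mk_eq_mk ((hFf _ hw (hΨX w hw) h1).symm.trans (hFf' _ hw (hΨX w hw) h2)) i j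
  obtain ⟨p, hp⟩ := hG.exists_eq_mul key
  have hsm : polyMap F' (polyMap Ψ z) = eval z p • polyMap G z := by
    funext j
    rw [polyMap_apply, ← eval_bind₁, hp]
    simp
  have hGz : polyMap G z ≠ 0 := by
    intro h0
    exact hFz' (by rw [hsm, h0, smul_zero])
  refine ⟨hGz, ?_⟩
  rw [hFf' _ hz hX hFz', mk_congr hsm hFz' (hsm ▸ hFz'), mk_smul]

theorem IsPrimitiveTuple.map_equiv {G : κ → MvPolynomial σ ℂ} (hG : IsPrimitiveTuple G)
    (e : MvPolynomial σ ℂ ≃ₐ[ℂ] MvPolynomial σ ℂ) : IsPrimitiveTuple fun j => e (G j) := by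
  intro g hg
  have : IsUnit (e.symm g) := hG _ fun j => by
    have := map_dvd e.symm (hg j)
    rwa [AlgEquiv.symm_apply_apply] at this
  rw [← e.apply_symm_apply g]
  exact this.map e

/-- Rescaling of the variables. -/
def scaleVars (s : σ → ℂˣ) : MvPolynomial σ ℂ ≃ₐ[ℂ] MvPolynomial σ ℂ :=
  AlgEquiv.ofAlgHom (aeval fun i => C (s i : ℂ) * X i) (aeval fun i => C ((s i)⁻¹ : ℂ) * X i)
    (by
      ext i : 1
      simp only [AlgHom.comp_apply, aeval_X, map_mul, algHom_C, algebraMap_eq, AlgHom.id_apply]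
      rw [← mul_assoc, ← C_mul]
      simp)
    (by
      ext i : 1
      simp only [AlgHom.comp_apply, aeval_X, map_mul, algHom_C, algebraMap_eq, AlgHom.id_apply]
      rw [← mul_assoc, ← C_mul]
      simp)

theorem eval_scaleVars (s : σ → ℂˣ) (z : σ → ℂ) (P : MvPolynomial σ ℂ) :
    eval z (scaleVars s P) = eval (fun i => s i * z i) P := by
  have h : (scaleVars s P) = bind₁ (fun i => C (s i : ℂ) * X i) P := rfl
  rw [h, eval_bind₁]
  congr 2
  funext i
  simp

theorem coeff_scaleVars (s : σ → ℂˣ) (P : MvPolynomial σ ℂ) (m : σ →₀ ℕ) :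
    coeff m (scaleVars s P) = m.prod (fun i n => (s i : ℂ) ^ n) * coeff m P := by
  classical
  induction P using MvPolynomial.induction_on' with
  | monomial u a =>
    have h : scaleVars s (monomial u a) = monomial u (u.prod (fun i n => (s i : ℂ) ^ n) * a) := by
      change aeval (fun i => C (s i : ℂ) * X i) (monomial u a) = _
      rw [aeval_monomial, monomial_eq (a := _ * a)]
      simp only [mul_pow, Finsupp.prod_mul, algebraMap_eq, C_mul]
      rw [show (u.prod fun i n => (C (s i : ℂ) : MvPolynomial σ ℂ) ^ n) =
        C (u.prod fun i n => (s i : ℂ) ^ n) by simp [Finsupp.prod]]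
      ring
    rw [h, coeff_monomial, coeff_monomial]
    split_ifs with hum
    · rw [hum]
    · rw [mul_zero]
  | add p q hp hq => rw [map_add, coeff_add, coeff_add, hp, hq, mul_add]

/-- If `f` composed with `Ψ` is invariant under a rescaling of the variables, then the primitive
tuple that describes it is an eigenvector. -/
theorem Represents.exists_scaleVars_eq [Fintype κ] {X : Set (ℙ ℂ (ι → ℂ))}
    {Y : Set (ℙ ℂ (κ → ℂ))} {f : X → Y} {Ψ : ι → MvPolynomial σ ℂ} (hΨ : ∃ z, polyMap Ψ z ≠ 0)
    (hΨX : ∀ z (hz : polyMap Ψ z ≠ 0), Projectivization.mk ℂ (polyMap Ψ z) hz ∈ X)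
    {G : κ → MvPolynomial σ ℂ} (hG : Represents f Ψ G) (hp : IsPrimitiveTuple G)
    (s : σ → ℂˣ) {a : ℂ} (ha : a ≠ 0)
    (hs : ∀ z, polyMap Ψ (fun i => s i * z i) = a • polyMap Ψ z) :
    ∃ c : ℂ, c ≠ 0 ∧ ∀ j, scaleVars s (G j) = C c * G j := by
  refine hG.exists_eq_C_mul hΨ hΨX (G' := fun j => scaleVars s (G j)) ?_ hp
    (hp.map_equiv (scaleVars s))
  intro z hz hX
  have hz' : polyMap Ψ (fun i => s i * z i) ≠ 0 := by
    rw [hs]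
    exact smul_ne_zero ha hz
  obtain ⟨h1, h2⟩ := hG _ hz' (hΨX _ hz')
  have h3 : polyMap (fun j => scaleVars s (G j)) z = polyMap G (fun i => s i * z i) := by
    funext j
    exact eval_scaleVars s z (G j)
  refine ⟨h3 ▸ h1, ?_⟩
  rw [mk_congr h3 (h3 ▸ h1) h1, ← h2]
  congr 2
  refine Subtype.ext ?_
  change Projectivization.mk ℂ (polyMap Ψ z) hz = Projectivization.mk ℂ (polyMap Ψ _) hz'
  rw [mk_congr (hs z) hz' (hs z ▸ hz'), mk_smul]

/-- Eigenvectors of the rescaling by `2` are homogeneous. -/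
theorem exists_isHomogeneous_of_scaleVars_eq {G : κ → MvPolynomial σ ℂ} {c : ℂ}
    (h : ∀ j, scaleVars (fun _ => Units.mk0 (2 : ℂ) two_ne_zero) (G j) = C c * G j)
    (h0 : ∃ j, G j ≠ 0) : ∃ k : ℕ, c = 2 ^ k ∧ ∀ j, (G j).IsHomogeneous k := by
  -- Scaling by 2 multiplies a monomial by 2 to its degree, so all monomials that occur share one
  -- degree.
  have key : ∀ j m, coeff m (G j) ≠ 0 → (2 : ℂ) ^ m.degree = c := by
    intro j m hm
    have h1 := congrArg (coeff m) (h j)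
    rw [coeff_scaleVars, coeff_C_mul] at h1
    have h2 := mul_right_cancel₀ hm h1
    rw [← h2]
    simp [Finsupp.prod, Finsupp.degree_apply, Finset.prod_pow_eq_pow_sum]
  obtain ⟨j, hj⟩ := h0
  obtain ⟨m, hm⟩ := MvPolynomial.ne_zero_iff.1 hj
  refine ⟨m.degree, (key j m hm).symm, fun j' m' hm' => ?_⟩
  have h1 := (key j' m' hm').trans (key j m hm).symm
  have h2 : m'.degree = m.degree := by
    have : (2 : ℕ) ^ m'.degree = 2 ^ m.degree := by exact_mod_cast h1
    exact Nat.pow_right_injective le_rfl this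
  rw [← h2, Finsupp.degree_eq_weight_one]
  rfl

/-- A polynomial in two variables without zeros outside the origin is constant. -/
theorem eq_C_of_forall_eval_ne_zero {h : MvPolynomial (Fin 2) ℂ}
    (hh : ∀ v : Fin 2 → ℂ, v ≠ 0 → eval v h ≠ 0) : ∃ c : ℂ, c ≠ 0 ∧ h = C c := by
  -- On an affine line that misses the origin, `h` restricts to a one-variable polynomial without
  -- roots, hence to a constant.
  have key : ∀ (u w : Fin 2 → ℂ), (∀ t : ℂ, u + t • w ≠ 0) → ∀ t : ℂ,
      eval (u + t • w) h = eval u h := by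
    intro u w huw
    let p : Polynomial ℂ := aeval (fun i => Polynomial.C (u i) + Polynomial.X * Polynomial.C (w i)) h
    have hp : ∀ t, p.eval t = eval (u + t • w) h := by
      intro t
      have := congrFun (congrArg DFunLike.coe (MvPolynomial.comp_aeval
        (fun i => Polynomial.C (u i) + Polynomial.X * Polynomial.C (w i))
        (Polynomial.aeval (R := ℂ) t))) h
      simp only [AlgHom.comp_apply] at this
      rw [← Polynomial.coe_aeval_eq_eval, this]
      rw [MvPolynomial.aeval_eq_eval]
      congr 2
      funext i
      simp only [map_add, map_mul, Polynomial.aeval_X, Polynomial.aeval_C, Pi.add_apply,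
        Pi.smul_apply, smul_eq_mul, Algebra.algebraMap_self, RingHom.id_apply]
    have hdeg : p.degree ≤ 0 := by
      by_contra hd
      obtain ⟨t, ht⟩ := IsAlgClosed.exists_root p (fun h => hd h.le)
      exact hh _ (huw t) (by rw [← hp]; exact ht)
    intro t
    have h0 := hp 0
    rw [zero_smul, add_zero] at h0
    rw [← hp, ← h0, Polynomial.eq_C_of_degree_le_zero hdeg, Polynomial.eval_C, Polynomial.eval_C]
  have h1 : ∀ s t : ℂ, s ≠ 0 → eval ![t, s] h = eval ![0, s] h := by
    intro s t hs
    have := key ![0, s] ![1, 0] (fun t h0 => hs (by simpa using congrFun h0 1)) t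
    simpa using this
  have h2 : ∀ s t : ℂ, t ≠ 0 → eval ![t, s] h = eval ![t, 0] h := by
    intro s t ht
    have := key ![t, 0] ![0, 1] (fun s h0 => ht (by simpa using congrFun h0 0)) s
    simpa using this
  have h3 : ∀ s t : ℂ, s ≠ 0 → t ≠ 0 → eval ![t, s] h = eval ![1, 1] h := by
    intro s t hs ht
    rw [h1 s t hs, ← h1 s 1 hs, h2 s 1 one_ne_zero, ← h2 1 1 one_ne_zero]
  refine ⟨eval ![1, 1] h, hh _ (fun h0 => one_ne_zero (congrFun h0 0)), ?_⟩
  -- The horizontal and vertical lines above only join points off the axes; the factor `X 0 * X 1`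
  -- takes care of the axes.
  have hX : (X 0 * X 1 : MvPolynomial (Fin 2) ℂ) ≠ 0 := mul_ne_zero (X_ne_zero _) (X_ne_zero _)
  refine mul_left_cancel₀ hX (MvPolynomial.funext fun v => ?_)
  simp only [map_mul, eval_X, eval_C]
  by_cases hv0 : v 0 = 0
  · simp [hv0]
  by_cases hv1 : v 1 = 0
  · simp [hv1]
  rw [← h3 _ _ hv1 hv0]
  congr 3
  funext i
  fin_cases i <;> rfl

/-- A nonconstant common factor would vanish somewhere outside the origin, and the whole tuple with
it. -/
theorem isPrimitiveTuple_of_forall_ne_zero {G : κ → MvPolynomial (Fin 2) ℂ}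
    (hG : ∀ v : Fin 2 → ℂ, v ≠ 0 → polyMap G v ≠ 0) : IsPrimitiveTuple G := by
  intro g hg
  obtain ⟨c, hc, rfl⟩ := eq_C_of_forall_eval_ne_zero (h := g) (fun v hv h0 => hG v hv (by
    funext j
    obtain ⟨q, hq⟩ := hg j
    simp [hq, h0]))
  exact (isUnit_iff_ne_zero.2 hc).map C

end ProjVar

/-! ### Automorphisms of the projective line -/

namespace ProjVar

open MvPolynomial

/-- Binary forms of degree `d` are linear combinations of the monomials. -/
theorem exists_eval_eq_sum_of_isHomogeneous {d : ℕ} {F : MvPolynomial (Fin 2) ℂ}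
    (hF : F.IsHomogeneous d) : ∃ m : Fin (d + 1) → ℂ, ∀ v : Fin 2 → ℂ,
      eval v F = ∑ j, m j * (v 0 ^ (d - (j : ℕ)) * v 1 ^ (j : ℕ)) := by
  refine ⟨fun j => ∑ e ∈ F.support, if e 1 = j then coeff e F else 0, fun v => ?_⟩
  simp only [Finset.sum_mul]
  rw [Finset.sum_comm, eval_eq']
  refine Finset.sum_congr rfl fun e he => ?_
  have hdeg : e 0 + e 1 = d := by
    have h := hF (MvPolynomial.mem_support_iff.mp he)
    rw [Finsupp.weight_apply, Finsupp.sum_fintype _ _ (by simp), Fin.sum_univ_two] at h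
    simpa using h
  rw [Finset.sum_eq_single (⟨e 1, by omega⟩ : Fin (d + 1))]
  · simp only [if_true, Fin.prod_univ_two]
    rw [show d - e 1 = e 0 by omega]
  · intro j _ hj
    rw [if_neg, zero_mul]
    exact fun h => hj (Fin.ext h.symm)
  · simp

theorem polyMap_X {ι : Type*} (z : ι → ℂ) : polyMap (X : ι → MvPolynomial ι ℂ) z = z := by
  funext i
  simp

theorem isPrimitiveTuple_X : IsPrimitiveTuple (X : Fin 2 → MvPolynomial (Fin 2) ℂ) :=
  isPrimitiveTuple_of_forall_ne_zero fun v hv => by rwa [polyMap_X]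

/-- A regular map from the projective line is given by one tuple of forms, which have no common
zero. -/
theorem exists_global_polyMap {κ : Type*} [Fintype κ] {Y : Set (ℙ ℂ (κ → ℂ))}
    {f : projectiveLine → Y} (hf : IsRegularMap f) : ∃ (m : ℕ) (G : κ → MvPolynomial (Fin 2) ℂ),
      (∀ j, (G j).IsHomogeneous m) ∧ ∀ v (hv : v ≠ 0), ∃ h : polyMap G v ≠ 0,
        (f ⟨Projectivization.mk ℂ v hv, trivial⟩).1 = Projectivization.mk ℂ (polyMap G v) h := by
  have hΨ : ∃ z, polyMap (X : Fin 2 → MvPolynomial (Fin 2) ℂ) z ≠ 0 := ⟨1, by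
    rw [polyMap_X]; exact one_ne_zero⟩
  obtain ⟨G, hG, hGf⟩ := hf.exists_represents hΨ fun z hz => Set.mem_univ _
  obtain ⟨c, -, hc⟩ := hGf.exists_scaleVars_eq hΨ (fun z hz => Set.mem_univ _) hG
    (fun _ => Units.mk0 (2 : ℂ) two_ne_zero) (a := 2) two_ne_zero (fun z => by
      rw [polyMap_X, polyMap_X]; rfl)
  obtain ⟨m, -, hm⟩ := exists_isHomogeneous_of_scaleVars_eq hc hG.exists_ne_zero
  refine ⟨m, G, hm, fun v hv => ?_⟩
  have h := hGf v (by rwa [polyMap_X]) trivial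
  simpa only [polyMap_X] using h

/-- Automorphisms of the projective line are linear. -/
theorem exists_matrix_of_mem_aut {f g : projectiveLine → projectiveLine} (hf : IsRegularMap f)
    (hg : IsRegularMap g) (hgf : ∀ x, g (f x) = x) : ∃ M : Matrix (Fin 2) (Fin 2) ℂ,
      ∀ v (hv : v ≠ 0), ∃ h : M.mulVec v ≠ 0,
        (f ⟨Projectivization.mk ℂ v hv, trivial⟩).1 = Projectivization.mk ℂ (M.mulVec v) h := by
  obtain ⟨m, G, hGm, hG⟩ := exists_global_polyMap hf
  obtain ⟨m', G', hGm', hG'⟩ := exists_global_polyMap hg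
  have hcomp : ∀ v (hv : v ≠ 0), ∃ h : polyMap G' (polyMap G v) ≠ 0,
      Projectivization.mk ℂ v hv = Projectivization.mk ℂ (polyMap G' (polyMap G v)) h := by
    intro v hv
    obtain ⟨h1, h2⟩ := hG v hv
    obtain ⟨h3, h4⟩ := hG' _ h1
    refine ⟨h3, ?_⟩
    rw [← h4]
    have h5 := hgf ⟨Projectivization.mk ℂ v hv, trivial⟩
    have h6 : f ⟨Projectivization.mk ℂ v hv, trivial⟩ =
      ⟨Projectivization.mk ℂ (polyMap G v) h1, trivial⟩ := Subtype.ext h2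
    rw [h6] at h5
    rw [h5]
  -- The composite tuple has no zeros outside the origin and is proportional to the variables, so it
  -- is a constant multiple of them.
  have hprim : IsPrimitiveTuple fun j => bind₁ G (G' j) :=
    isPrimitiveTuple_of_forall_ne_zero fun v hv => by
      rw [polyMap_bind₁]
      exact (hcomp v hv).1
  have hX : ∃ z, polyMap (X : Fin 2 → MvPolynomial (Fin 2) ℂ) z ≠ 0 := ⟨1, by
    rw [polyMap_X]; exact one_ne_zero⟩
  obtain ⟨c, hc, hcG⟩ := isPrimitiveTuple_X.exists_eq_C_mul hprim (by
    intro i j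
    refine eq_of_eval_eq_of_polyMap_ne_zero hX fun z hz => ?_
    rw [polyMap_X] at hz
    obtain ⟨h1, h2⟩ := hcomp z hz
    simpa [eval_bind₁] using mul_eq_of_mk_eq_mk h2 i j)
  have hcv : ∀ v, polyMap G' (polyMap G v) = c • v := by
    intro v
    rw [← polyMap_bind₁]
    funext j
    simp [hcG]
  -- Degrees multiply under composition: evaluation at `2 • 1` gives `2 ^ (m * m') = 2`.
  have hm : m = 1 := by
    have h1 := hcv ((2 : ℂ) • 1)
    rw [polyMap_smul hGm, polyMap_smul hGm', hcv] at h1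
    have h2 := congrFun h1 0
    simp only [Pi.smul_apply, Pi.one_apply, smul_eq_mul, mul_one] at h2
    rw [mul_comm] at h2
    have h3 := mul_left_cancel₀ hc h2
    rw [← pow_mul] at h3
    have h4 : 2 ^ (m * m') = 2 ^ 1 := by
      have : ((2 ^ (m * m') : ℕ) : ℂ) = ((2 ^ 1 : ℕ) : ℂ) := by push_cast; rw [h3]
      exact_mod_cast this
    exact Nat.eq_one_of_mul_eq_one_right (Nat.pow_right_injective le_rfl h4)
  subst hm
  choose N hN using fun j => exists_eval_eq_sum_of_isHomogeneous (hGm j)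
  have hM : ∀ v, polyMap G v = (Matrix.of N).mulVec v := by
    intro v
    funext j
    rw [polyMap_apply, hN]
    simp [Matrix.mulVec, dotProduct, Fin.sum_univ_two]
  refine ⟨Matrix.of N, fun v hv => ?_⟩
  simpa only [hM] using hG v hv

theorem isRegularMap_matrix {ι κ : Type*} [Fintype ι] {X : Set (ℙ ℂ (ι → ℂ))}
    {Y : Set (ℙ ℂ (κ → ℂ))} {f : X → Y} (M : Matrix κ ι ℂ)
    (h : ∀ v (hv : v ≠ 0) (hX : Projectivization.mk ℂ v hv ∈ X), ∃ h : M.mulVec v ≠ 0,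
        (f ⟨Projectivization.mk ℂ v hv, hX⟩).1 = Projectivization.mk ℂ (M.mulVec v) h) :
    IsRegularMap f := by
  have hM : ∀ v, polyMap (fun i => ∑ j, C (M i j) * MvPolynomial.X j) v = M.mulVec v := by
    intro v
    funext i
    simp [Matrix.mulVec, dotProduct]
  refine isRegularMap_of_polyMap fun v hv hX => ⟨1, fun i => ∑ j, C (M i j) * MvPolynomial.X j,
    fun i => ?_, ?_, ?_⟩
  · exact IsHomogeneous.sum _ _ _ fun j _ => by
      simpa using (isHomogeneous_C ι (M i j)).mul (isHomogeneous_X ℂ j)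
  · rw [hM]
    exact (h v hv hX).1
  · intro w hw hwX h0
    obtain ⟨h1, h2⟩ := h w hw hwX
    rw [h2]
    exact mk_congr (hM w).symm _ _

theorem isRegularMap_smul (g : Matrix.GeneralLinearGroup (Fin 2) ℂ)
    {f : projectiveLine → projectiveLine} (hf : ∀ p, (f p).1 = g • p.1) : IsRegularMap f :=
  isRegularMap_matrix g.1 fun _ hv _ =>
    ⟨(smul_ne_zero_iff_ne g).2 hv, (hf _).trans rfl⟩

/-- The automorphism of the projective line given by an element of `PGL(2, ℂ)`. -/
def pglToAut : Matrix.ProjGenLinGroup (Fin 2) ℂ →* Aut projectiveLine where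
  toFun g := ⟨(Equiv.Set.univ _).symm.permCongr (MulAction.toPerm g), by
    induction g using Matrix.ProjGenLinGroup.induction_on with | mk g =>
    exact ⟨isRegularMap_smul g fun p => rfl, isRegularMap_smul g⁻¹ fun p => rfl⟩⟩
  map_one' := by
    ext p
    exact one_smul (Matrix.ProjGenLinGroup (Fin 2) ℂ) p.1
  map_mul' g h := by
    ext p
    exact mul_smul g h p.1

theorem pglToAut_apply (g : Matrix.ProjGenLinGroup (Fin 2) ℂ) (p : projectiveLine) :
    ((pglToAut g).1 p).1 = g • p.1 := rfl

theorem pglToAut_injective : Function.Injective pglToAut := by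
  rw [injective_iff_map_eq_one]
  intro g hg
  induction g using Matrix.ProjGenLinGroup.induction_on with | mk g =>
  have h : ∀ v (hv : v ≠ 0), ∀ i j, (g.1.mulVec v) i * v j = (g.1.mulVec v) j * v i := by
    intro v hv i j
    have h1 : g • Projectivization.mk ℂ v hv = Projectivization.mk ℂ v hv := by
      have := pglToAut_apply (Matrix.ProjGenLinGroup.mk g) ⟨Projectivization.mk ℂ v hv, trivial⟩
      rw [hg] at this
      exact this.symm
    exact mul_eq_of_mk_eq_mk (hv := (smul_ne_zero_iff_ne g).2 hv) h1 i j
  -- The two basis vectors force a diagonal matrix, and their sum forces equal diagonal entries.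
  have h10 := h ![1, 0] (by intro h; simpa using congrFun h 0) 1 0
  have h01 := h ![0, 1] (by intro h; simpa using congrFun h 1) 1 0
  have h11 := h ![1, 1] (by intro h; simpa using congrFun h 1) 1 0
  simp [Matrix.mulVec, dotProduct, Fin.sum_univ_two] at h10 h01 h11
  rw [Matrix.ProjGenLinGroup.mk_eq_one, Matrix.GeneralLinearGroup.center_eq_range_scalar]
  have hdet : IsUnit g.1.det := (Matrix.isUnit_iff_isUnit_det _).1 g.isUnit
  rw [Matrix.det_fin_two, h10, mul_zero, sub_zero] at hdet
  refine ⟨Units.mk0 (g.1 0 0) (left_ne_zero_of_mul hdet.ne_zero), ?_⟩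
  ext i j
  fin_cases i <;> fin_cases j <;> (simp [h10, h01]; try grind)

theorem pglToAut_surjective : Function.Surjective pglToAut := by
  rintro ⟨ψ, hψ, hψ'⟩
  obtain ⟨M, hM⟩ := exists_matrix_of_mem_aut hψ hψ' ψ.symm_apply_apply
  have hdet : M.det ≠ 0 := by
    intro h0
    obtain ⟨v, hv, hMv⟩ := Matrix.exists_mulVec_eq_zero_iff.2 h0
    exact (hM v hv).1 hMv
  refine ⟨Matrix.ProjGenLinGroup.mk (Matrix.GeneralLinearGroup.mkOfDetNeZero M hdet), ?_⟩
  refine Subtype.ext (Equiv.ext fun p => Subtype.ext ?_)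
  obtain ⟨p, hp⟩ := p
  induction p using Projectivization.ind with | _ v hv =>
  obtain ⟨h, h1⟩ := hM v hv
  exact h1.symm

/-- The automorphism group of the projective line is `PGL(2, ℂ)`. -/
def pglEquivAut : Matrix.ProjGenLinGroup (Fin 2) ℂ ≃* Aut projectiveLine :=
  MulEquiv.ofBijective pglToAut ⟨pglToAut_injective, pglToAut_surjective⟩

end ProjVar

/-! ### The Veronese isomorphism onto the rational normal curve -/

namespace ProjVar

open MvPolynomial

/-- Isomorphic varieties have isomorphic automorphism groups. -/
def autCongr {ι κ : Type*} {X : Set (ℙ ℂ (ι → ℂ))} {Y : Set (ℙ ℂ (κ → ℂ))} (e : X ≃ Y)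
    (he : IsRegularMap e) (he' : IsRegularMap e.symm) : Aut X ≃* Aut Y where
  toFun φ := ⟨e.permCongr φ.1, (he.comp φ.2.1).comp he', (he.comp φ.2.2).comp he'⟩
  invFun φ := ⟨e.symm.permCongr φ.1, (he'.comp φ.2.1).comp he, (he'.comp φ.2.2).comp he⟩
  left_inv φ := by
    ext x
    simp
  right_inv φ := by
    ext x
    simp
  map_mul' φ ψ := by
    ext x
    simp

/-- The vector of monomials of degree `d` in two variables. -/
def powerVec (d : ℕ) (v : Fin 2 → ℂ) : Fin (d + 1) → ℂ :=
  fun i => v 0 ^ (d - (i : ℕ)) * v 1 ^ (i : ℕ)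

theorem powerVec_smul (d : ℕ) (a : ℂ) (v : Fin 2 → ℂ) :
    powerVec d (a • v) = a ^ d • powerVec d v := by
  funext i
  simp only [powerVec, Pi.smul_apply, smul_eq_mul, mul_pow]
  have : a ^ d = a ^ (d - (i : ℕ)) * a ^ (i : ℕ) := by rw [← pow_add]; congr 1; omega
  rw [this]
  ring

theorem powerVec_zero (d : ℕ) (v : Fin 2 → ℂ) : powerVec d v 0 = v 0 ^ d := by
  simp [powerVec]

theorem powerVec_last (d : ℕ) (v : Fin 2 → ℂ) : powerVec d v (Fin.last d) = v 1 ^ d := by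
  simp [powerVec]

theorem powerVec_ne_zero (d : ℕ) {v : Fin 2 → ℂ} (hv : v ≠ 0) : powerVec d v ≠ 0 := by
  intro h
  have h0 := congrFun h 0
  have h1 := congrFun h (Fin.last d)
  rw [powerVec_zero] at h0
  rw [powerVec_last] at h1
  refine hv (funext fun i => ?_)
  fin_cases i
  · exact eq_zero_of_pow_eq_zero h0
  · exact eq_zero_of_pow_eq_zero h1

theorem veronese_mk (d : ℕ) (v : Fin 2 → ℂ) (hv : v ≠ 0) :
    veronese d (Projectivization.mk ℂ v hv) =
      Projectivization.mk ℂ (powerVec d v) (powerVec_ne_zero d hv) := by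
  obtain ⟨a, ha, h⟩ := exists_rep_eq_smul v hv
  have h1 : veronese d (Projectivization.mk ℂ v hv) =
    Projectivization.mk ℂ (powerVec d (Projectivization.mk ℂ v hv).rep)
      (powerVec_ne_zero d (Projectivization.rep_nonzero _)) := rfl
  have h2 : powerVec d (Projectivization.mk ℂ v hv).rep = a ^ d • powerVec d v := by
    rw [h, powerVec_smul]
  rw [h1, mk_congr h2 _ (h2 ▸ powerVec_ne_zero d (Projectivization.rep_nonzero _)), mk_smul]

theorem mk_powerVec_mem (d : ℕ) {v : Fin 2 → ℂ} (hv : v ≠ 0) (h : powerVec d v ≠ 0) :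
    Projectivization.mk ℂ (powerVec d v) h ∈ rationalNormalCurve d :=
  ⟨_, veronese_mk d v hv⟩

theorem exists_of_mk_mem_rationalNormalCurve {d : ℕ} {x : Fin (d + 1) → ℂ} {hx : x ≠ 0}
    (h : Projectivization.mk ℂ x hx ∈ rationalNormalCurve d) :
    ∃ (v : Fin 2 → ℂ) (a : ℂ), v ≠ 0 ∧ a ≠ 0 ∧ x = a • powerVec d v := by
  obtain ⟨p, hp⟩ := h
  induction p using Projectivization.ind with | _ v hv =>
  rw [veronese_mk] at hp
  obtain ⟨a, ha⟩ := (Projectivization.mk_eq_mk_iff' ℂ _ _ _ _).1 hp.symm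
  refine ⟨v, a, hv, ?_, ha.symm⟩
  rintro rfl
  exact hx (by rw [← ha, zero_smul])

/-- The monomials of degree `d` in two variables. -/
def powerTuple (d : ℕ) (i : Fin (d + 1)) : MvPolynomial (Fin 2) ℂ :=
  X 0 ^ (d - (i : ℕ)) * X 1 ^ (i : ℕ)

theorem polyMap_powerTuple (d : ℕ) (v : Fin 2 → ℂ) : polyMap (powerTuple d) v = powerVec d v := by
  funext i
  simp [powerTuple, powerVec]

theorem isHomogeneous_powerTuple (d : ℕ) (i : Fin (d + 1)) : (powerTuple d i).IsHomogeneous d := by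
  have := (isHomogeneous_X_pow (R := ℂ) (0 : Fin 2) (d - (i : ℕ))).mul
    (isHomogeneous_X_pow (R := ℂ) (1 : Fin 2) (i : ℕ))
  rwa [Nat.sub_add_cancel (by omega)] at this

/-- The Veronese map onto the rational normal curve. -/
def veroneseRange (d : ℕ) (p : projectiveLine) : rationalNormalCurve d :=
  ⟨veronese d p.1, Set.mem_range_self p.1⟩

theorem isRegularMap_veroneseRange (d : ℕ) : IsRegularMap (veroneseRange d) := by
  refine isRegularMap_of_polyMap fun v hv hX =>
    ⟨d, powerTuple d, isHomogeneous_powerTuple d, ?_, fun w hw hwX h => ?_⟩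
  · rw [polyMap_powerTuple]
    exact powerVec_ne_zero d hv
  · exact (veronese_mk d w hw).trans (mk_congr (polyMap_powerTuple d w).symm _ _)

/-- Consecutive coordinates of a point of the curve recover the parameter. -/
theorem exists_eq_smul_of_powerVec {d : ℕ} (i j : Fin (d + 1)) (hij : (j : ℕ) = i + 1)
    (v : Fin 2 → ℂ) : ![powerVec d v i, powerVec d v j] =
      (v 0 ^ (d - (j : ℕ)) * v 1 ^ (i : ℕ)) • v := by
  have h : d - (i : ℕ) = (d - (j : ℕ)) + 1 := by omega
  funext l
  fin_cases l
  · simp [powerVec, h, pow_succ]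
    ring
  · simp [powerVec, hij, pow_succ]
    ring

theorem veroneseRange_injective {d : ℕ} (hd : 1 ≤ d) : Function.Injective (veroneseRange d) := by
  rintro ⟨p, hp⟩ ⟨q, hq⟩ hpq
  have hpq' : veronese d p = veronese d q := congrArg Subtype.val hpq
  refine Subtype.ext ?_
  change p = q
  induction p using Projectivization.ind with | _ v hv =>
  induction q using Projectivization.ind with | _ w hw =>
  rw [veronese_mk, veronese_mk] at hpq'
  obtain ⟨a, ha⟩ := (Projectivization.mk_eq_mk_iff' ℂ _ _ _ _).1 hpq'
  have key : ∀ (i j : Fin (d + 1)), (j : ℕ) = i + 1 →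
      (v 0 ^ (d - (j : ℕ)) * v 1 ^ (i : ℕ)) • v =
        (a * (w 0 ^ (d - (j : ℕ)) * w 1 ^ (i : ℕ))) • w := by
    intro i j hij
    rw [← exists_eq_smul_of_powerVec i j hij, mul_smul, ← exists_eq_smul_of_powerVec i j hij, ← ha]
    simp
  have fin : ∀ c b : ℂ, c ≠ 0 → c • v = b • w →
      Projectivization.mk ℂ v hv = Projectivization.mk ℂ w hw := by
    intro c b hc h
    refine (Projectivization.mk_eq_mk_iff' ℂ _ _ _ _).2 ⟨c⁻¹ * b, ?_⟩
    rw [mul_smul, ← h, inv_smul_smul₀ hc]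
  -- The first two coordinates are `v` times `v 0 ^ (d - 1)`, the last two are `v` times `v 1 ^ (d -
  -- 1)`; one of these factors is nonzero.
  by_cases h0 : v 0 = 0
  · have h1 : v 1 ≠ 0 := by
      intro h1
      exact hv (funext fun i => by fin_cases i <;> assumption)
    refine fin _ _ ?_ (key ⟨d - 1, by omega⟩ (Fin.last d) (by simp; omega))
    simp [h1]
  · refine fin _ _ ?_ (key 0 ⟨1, by omega⟩ rfl)
    simp [h0]

/-- The Veronese map, as a bijection of the line and the curve. -/
def veroneseEquiv {d : ℕ} (hd : 1 ≤ d) : projectiveLine ≃ rationalNormalCurve d :=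
  Equiv.ofBijective (veroneseRange d) ⟨veroneseRange_injective hd, by
    rintro ⟨_, p, rfl⟩
    exact ⟨⟨p, trivial⟩, rfl⟩⟩

theorem isRegularMap_veroneseEquiv_symm {d : ℕ} (hd : 1 ≤ d) :
    IsRegularMap (veroneseEquiv hd).symm := by
  -- The inverse is the projection to two consecutive coordinates; the first two and the last two
  -- together cover the curve.
  have key : ∀ (i j : Fin (d + 1)), (j : ℕ) = i + 1 →
      ∀ (w : Fin (d + 1) → ℂ) (hw : w ≠ 0)
        (hwX : Projectivization.mk ℂ w hw ∈ rationalNormalCurve d)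
        (h : polyMap ![(X i : MvPolynomial (Fin (d + 1)) ℂ), X j] w ≠ 0),
        ((veroneseEquiv hd).symm ⟨Projectivization.mk ℂ w hw, hwX⟩).1 =
          Projectivization.mk ℂ (polyMap ![X i, X j] w) h := by
    intro i j hij w hw hwX h
    obtain ⟨v, a, hv, ha, rfl⟩ := exists_of_mk_mem_rationalNormalCurve hwX
    have h1 : (veroneseEquiv hd).symm ⟨Projectivization.mk ℂ (a • powerVec d v) hw, hwX⟩ =
        ⟨Projectivization.mk ℂ v hv, trivial⟩ := by
      rw [Equiv.symm_apply_eq]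
      refine Subtype.ext ?_
      change Projectivization.mk ℂ _ hw = veronese d _
      rw [veronese_mk, mk_smul]
    have h2 : polyMap ![(X i : MvPolynomial (Fin (d + 1)) ℂ), X j] (a • powerVec d v) =
        (a * (v 0 ^ (d - (j : ℕ)) * v 1 ^ (i : ℕ))) • v := by
      rw [mul_smul, ← exists_eq_smul_of_powerVec i j hij]
      funext l
      fin_cases l <;> simp
    rw [h1, mk_congr h2 h (h2 ▸ h), mk_smul]
  have hom : ∀ (i j : Fin (d + 1)) (l : Fin 2),
      ((![X i, X j] : Fin 2 → MvPolynomial (Fin (d + 1)) ℂ) l).IsHomogeneous 1 := by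
    intro i j l
    fin_cases l
    · exact isHomogeneous_X ℂ i
    · exact isHomogeneous_X ℂ j
  refine isRegularMap_of_polyMap fun x hx hX => ?_
  obtain ⟨v, a, hv, ha, rfl⟩ := exists_of_mk_mem_rationalNormalCurve hX
  by_cases h0 : v 0 = 0
  · have h1 : v 1 ≠ 0 := by
      intro h1
      exact hv (funext fun i => by fin_cases i <;> assumption)
    refine ⟨1, _, hom ⟨d - 1, by omega⟩ (Fin.last d), fun h => ?_,
      key ⟨d - 1, by omega⟩ (Fin.last d) (by simp; omega)⟩
    have := congrFun h 1
    simp [powerVec_last, ha, h1] at this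
  · refine ⟨1, _, hom 0 ⟨1, by omega⟩, fun h => ?_, key 0 ⟨1, by omega⟩ rfl⟩
    have := congrFun h 0
    simp [powerVec_zero, ha, h0] at this

/-- The Veronese map identifies the automorphisms of the line with those of the curve. -/
def veroneseAut {d : ℕ} (hd : 1 ≤ d) : Aut projectiveLine ≃* Aut (rationalNormalCurve d) :=
  autCongr (veroneseEquiv hd) (isRegularMap_veroneseRange d) (isRegularMap_veroneseEquiv_symm hd)

theorem veroneseAut_apply {d : ℕ} (hd : 1 ≤ d) (ψ : Aut projectiveLine) (p : projectiveLine) :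
    ((veroneseAut hd ψ).1 ⟨veronese d p.1, Set.mem_range_self p.1⟩).1 = veronese d (ψ.1 p).1 := by
  have h : (veroneseEquiv hd).symm ⟨veronese d p.1, Set.mem_range_self p.1⟩ = p := by
    rw [Equiv.symm_apply_eq]
    rfl
  change (veroneseEquiv hd (ψ.1 ((veroneseEquiv hd).symm _))).1 = _
  rw [h]
  rfl

end ProjVar

/-! ### The secant variety: parametrization, ideal and linear action -/

namespace ProjVar

open MvPolynomial

/-- The closure tests polynomials only at chosen representatives. Since I(X) is defined by vanishing
on the whole cone, it is stable under homotheties, so the choice is immaterial. -/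
theorem ideal_zariskiClosure {ι : Type*} (X : Set (ℙ ℂ (ι → ℂ))) :
    ideal (zariskiClosure X) = ideal X := by
  have hsmul : ∀ F ∈ ideal X, ∀ a : ℂˣ, scaleVars (fun _ => a) F ∈ ideal X := by
    intro F hF a
    rw [mem_ideal_iff] at hF ⊢
    intro v hv hX
    have h : (fun i => (a : ℂ) * v i) = (a : ℂ) • v := rfl
    rw [eval_scaleVars, h]
    exact hF _ (smul_ne_zero a.ne_zero hv) (by rwa [mk_smul])
  refine le_antisymm (fun F hF => ?_) fun F hF => ?_
  · rw [mem_ideal_iff] at hF ⊢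
    exact fun v hv hX => hF v hv (subset_zariskiClosure X hX)
  · rw [mem_ideal_iff]
    intro v hv hX
    obtain ⟨a, ha, hav⟩ := exists_rep_eq_smul v hv
    have h := hX _ (hsmul F hF (Units.mk0 a⁻¹ (inv_ne_zero ha)))
    rw [eval_scaleVars, hav] at h
    rw [← h]
    congr 2
    funext i
    simp [ha]

theorem mk_mem_zariskiClosure_iff {ι : Type*} {X : Set (ℙ ℂ (ι → ℂ))} {v : ι → ℂ} (hv : v ≠ 0) :
    Projectivization.mk ℂ v hv ∈ zariskiClosure X ↔ ∀ F ∈ ideal X, eval v F = 0 := by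
  constructor
  · intro h F hF
    rw [← ideal_zariskiClosure] at hF
    exact mem_ideal_iff.1 hF v hv h
  · intro h F hF
    obtain ⟨a, ha, hav⟩ := exists_rep_eq_smul v hv
    rw [hav]
    have := h (scaleVars (fun _ => Units.mk0 a ha) F) (by
      rw [mem_ideal_iff] at hF ⊢
      intro w hw hX
      have h : (fun i => ((Units.mk0 a ha : ℂˣ) : ℂ) * w i) = a • w := rfl
      rw [eval_scaleVars, h]
      exact hF _ (smul_ne_zero ha hw) (by rwa [mk_smul]))
    rwa [eval_scaleVars] at this

/-- At `![1, t]` the sum is a polynomial in `t` with coefficients `c j`. -/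
theorem eq_zero_of_sum_mul_powerVec {d : ℕ} {c : Fin (d + 1) → ℂ}
    (h : ∀ v, v ≠ 0 → ∑ j, c j * powerVec d v j = 0) : c = 0 := by
  have hp : (∑ j : Fin (d + 1), Polynomial.monomial (j : ℕ) (c j)) = 0 := by
    refine Polynomial.funext fun t => ?_
    have := h ![1, t] fun h0 => one_ne_zero (congrFun h0 0)
    simpa [powerVec, Polynomial.eval_finsetSum] using this
  funext j
  have := congrArg (Polynomial.coeff · (j : ℕ)) hp
  simpa [Polynomial.finsetSum_coeff, Polynomial.coeff_monomial, Fin.val_inj] using this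

theorem eq_top_of_powerVec_mem {d : ℕ} {T : Submodule ℂ (Fin (d + 1) → ℂ)}
    (h : ∀ v, v ≠ 0 → powerVec d v ∈ T) : T = ⊤ := by
  by_contra hT
  obtain ⟨f, hf, hfT⟩ := Submodule.exists_le_ker_of_lt_top T (lt_top_iff_ne_top.2 hT)
  apply hf
  have hsum : ∀ x : Fin (d + 1) → ℂ, f x = ∑ j, f (Pi.single j 1) * x j := by
    intro x
    rw [f.pi_apply_eq_sum_univ x]
    refine Finset.sum_congr rfl fun j _ => ?_
    rw [smul_eq_mul, mul_comm]
    congr 2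
    funext i
    simp [Pi.single_apply, eq_comm]
  have hc := eq_zero_of_sum_mul_powerVec (d := d) (c := fun j => f (Pi.single j 1)) fun v hv => by
    rw [← hsum]
    exact hfT (h v hv)
  refine LinearMap.ext fun x => ?_
  rw [hsum, LinearMap.zero_apply]
  exact Finset.sum_eq_zero fun j _ => by rw [show f (Pi.single j 1) = 0 from congrFun hc j, zero_mul]

/-- The union of the lines through two distinct points of the rational normal curve. -/
def secantLines (d : ℕ) : Set (ℙ ℂ (Fin (d + 1) → ℂ)) :=
  ⋃ (p ∈ rationalNormalCurve d) (q ∈ rationalNormalCurve d) (_ : p ≠ q), line p q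

theorem mem_secantLines {d : ℕ} {r : ℙ ℂ (Fin (d + 1) → ℂ)} : r ∈ secantLines d ↔
    ∃ p ∈ rationalNormalCurve d, ∃ q ∈ rationalNormalCurve d, p ≠ q ∧ r ∈ line p q := by
  simp only [secantLines, Set.mem_iUnion, exists_prop]

theorem mk_mem_line {ι : Type*} {x y z : ι → ℂ} {hx : x ≠ 0} {hy : y ≠ 0} {hz : z ≠ 0} :
    Projectivization.mk ℂ z hz ∈ line (Projectivization.mk ℂ x hx) (Projectivization.mk ℂ y hy) ↔
      ∃ a b : ℂ, a • x + b • y = z := by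
  rw [line, Set.mem_ofPred_eq, Projectivization.submodule_mk, Projectivization.submodule_mk,
    Projectivization.submodule_mk, Submodule.span_singleton_le_iff_mem, ← Submodule.span_insert,
    Submodule.mem_span_pair]

theorem rationalNormalCurve_subset_secantLines {d : ℕ} (hd : 1 ≤ d) :
    rationalNormalCurve d ⊆ secantLines d := by
  intro p hp
  have h : ∃ q ∈ rationalNormalCurve d, p ≠ q := by
    by_contra! hcon
    have h1 : veronese d (Projectivization.mk ℂ ![1, 0] fun h => one_ne_zero (congrFun h 0)) =
        veronese d (Projectivization.mk ℂ ![0, 1] fun h => one_ne_zero (congrFun h 1)) :=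
      (hcon _ ⟨_, rfl⟩).symm.trans (hcon _ ⟨_, rfl⟩)
    have h2 := veroneseRange_injective hd (a₁ := ⟨_, trivial⟩) (a₂ := ⟨_, trivial⟩)
      (Subtype.ext h1)
    have h3 := mul_eq_of_mk_eq_mk (congrArg Subtype.val h2) 0 1
    simp at h3
  obtain ⟨q, hq, hpq⟩ := h
  exact mem_secantLines.2 ⟨p, hp, q, hq, hpq, by
    rw [line, Set.mem_ofPred_eq]; exact le_sup_left⟩

theorem powerVec_zero_vec {d : ℕ} (hd : 1 ≤ d) : powerVec d 0 = 0 := by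
  have := powerVec_smul d 0 0
  rwa [zero_pow (by omega), zero_smul, zero_smul] at this

/-- In the degenerate cases, where a summand is zero or the two are proportional, the point lies on
the curve itself, which is contained in the secant lines. -/
theorem mk_powerVec_add_mem {d : ℕ} (hd : 1 ≤ d) {a b : Fin 2 → ℂ}
    (h : powerVec d a + powerVec d b ≠ 0) :
    Projectivization.mk ℂ (powerVec d a + powerVec d b) h ∈ secantLines d := by
  have hz := powerVec_zero_vec hd
  by_cases ha : a = 0
  · subst ha
    by_cases hb : b = 0
    · subst hb
      simp [hz] at h
    have h1 : powerVec d 0 + powerVec d b = powerVec d b := by rw [hz, zero_add]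
    rw [mk_congr h1 h (powerVec_ne_zero d hb)]
    exact rationalNormalCurve_subset_secantLines hd (mk_powerVec_mem d hb _)
  by_cases hb : b = 0
  · subst hb
    have h1 : powerVec d a + powerVec d 0 = powerVec d a := by rw [hz, add_zero]
    rw [mk_congr h1 h (powerVec_ne_zero d ha)]
    exact rationalNormalCurve_subset_secantLines hd (mk_powerVec_mem d ha _)
  have hpa := powerVec_ne_zero d ha
  have hpb := powerVec_ne_zero d hb
  by_cases hab : Projectivization.mk ℂ _ hpa = Projectivization.mk ℂ _ hpb
  · obtain ⟨c, hc⟩ := (Projectivization.mk_eq_mk_iff' ℂ _ _ _ _).1 hab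
    have h1 : powerVec d a + powerVec d b = (c + 1) • powerVec d b := by
      rw [← hc, add_smul, one_smul]
    rw [mk_congr h1 h (h1 ▸ h), mk_smul (h1 ▸ h) hpb]
    exact rationalNormalCurve_subset_secantLines hd (mk_powerVec_mem d hb _)
  · exact mem_secantLines.2 ⟨_, mk_powerVec_mem d ha hpa, _, mk_powerVec_mem d hb hpb, hab,
      mk_mem_line.2 ⟨1, 1, by simp⟩⟩

/-- A d-th root absorbs the scalar, so sums of two vectors of monomials already give all their
linear combinations. -/
theorem exists_smul_powerVec_eq {d : ℕ} (hd : 1 ≤ d) (c : ℂ) (v : Fin 2 → ℂ) :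
    ∃ w, c • powerVec d v = powerVec d w := by
  obtain ⟨z, hz⟩ := IsAlgClosed.exists_pow_nat_eq c (show 0 < d by omega)
  exact ⟨z • v, by rw [powerVec_smul, hz]⟩

theorem exists_powerVec_add_of_mem {d : ℕ} (hd : 1 ≤ d) {x : Fin (d + 1) → ℂ} {hx : x ≠ 0}
    (h : Projectivization.mk ℂ x hx ∈ secantLines d) :
    ∃ a b, x = powerVec d a + powerVec d b := by
  obtain ⟨_, ⟨p, rfl⟩, _, ⟨q, rfl⟩, -, hl⟩ := mem_secantLines.1 h
  induction p using Projectivization.ind with | _ v hv =>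
  induction q using Projectivization.ind with | _ w hw =>
  rw [veronese_mk, veronese_mk] at hl
  obtain ⟨s, t, rfl⟩ := mk_mem_line.1 hl
  obtain ⟨a, ha⟩ := exists_smul_powerVec_eq hd s v
  obtain ⟨b, hb⟩ := exists_smul_powerVec_eq hd t w
  exact ⟨a, b, by rw [ha, hb]⟩

/-- Parametrization of the affine cone over the secant lines. -/
def secantTuple (d : ℕ) (i : Fin (d + 1)) : MvPolynomial (Fin 2 ⊕ Fin 2) ℂ :=
  rename Sum.inl (powerTuple d i) + rename Sum.inr (powerTuple d i)

theorem polyMap_secantTuple (d : ℕ) (z : Fin 2 ⊕ Fin 2 → ℂ) :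
    polyMap (secantTuple d) z = powerVec d (z ∘ Sum.inl) + powerVec d (z ∘ Sum.inr) := by
  rw [← polyMap_powerTuple, ← polyMap_powerTuple]
  funext i
  simp [secantTuple, eval_rename]

theorem exists_polyMap_secantTuple_ne_zero (d : ℕ) : ∃ z, polyMap (secantTuple d) z ≠ 0 := by
  refine ⟨1, fun h => ?_⟩
  rw [polyMap_secantTuple] at h
  have := congrFun h 0
  simp only [Pi.add_apply, powerVec_zero] at this
  norm_num at this

theorem mk_polyMap_secantTuple_mem {d : ℕ} (hd : 1 ≤ d) (z : Fin 2 ⊕ Fin 2 → ℂ)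
    (hz : polyMap (secantTuple d) z ≠ 0) :
    Projectivization.mk ℂ (polyMap (secantTuple d) z) hz ∈ secantVariety d := by
  refine subset_zariskiClosure _ ?_
  rw [mk_congr (polyMap_secantTuple d z) hz (polyMap_secantTuple d z ▸ hz)]
  exact mk_powerVec_add_mem hd _

theorem ideal_secantVariety (d : ℕ) : ideal (secantVariety d) = ideal (secantLines d) :=
  ideal_zariskiClosure _

/-- Identifies the ideal with the kernel of a substitution, so that the homogeneous coordinate ring
embeds in a polynomial ring in four variables. -/
theorem mem_ideal_secantVariety {d : ℕ} (hd : 1 ≤ d) {F : MvPolynomial (Fin (d + 1)) ℂ} :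
    F ∈ ideal (secantVariety d) ↔ bind₁ (secantTuple d) F = 0 := by
  rw [ideal_secantVariety]
  constructor
  · intro h
    refine eq_of_eval_eq_of_polyMap_ne_zero (exists_polyMap_secantTuple_ne_zero d) fun z hz => ?_
    rw [eval_bind₁, map_zero]
    rw [← ideal_secantVariety] at h
    exact mem_ideal_iff.1 h _ hz (mk_polyMap_secantTuple_mem hd z hz)
  · intro h
    rw [mem_ideal_iff]
    intro v hv hX
    obtain ⟨a, b, rfl⟩ := exists_powerVec_add_of_mem hd hX
    have h1 : powerVec d a + powerVec d b = polyMap (secantTuple d) (Sum.elim a b) := by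
      rw [polyMap_secantTuple]; rfl
    rw [h1, ← eval_bind₁, h, map_zero]

theorem mem_ideal_secantVariety_iff_eval {d : ℕ} (hd : 1 ≤ d)
    {F : MvPolynomial (Fin (d + 1)) ℂ} :
    F ∈ ideal (secantVariety d) ↔ ∀ a b, eval (powerVec d a + powerVec d b) F = 0 := by
  rw [mem_ideal_secantVariety hd]
  constructor
  · intro h a b
    have h1 : powerVec d a + powerVec d b = polyMap (secantTuple d) (Sum.elim a b) := by
      rw [polyMap_secantTuple]; rfl
    rw [h1, ← eval_bind₁, h, map_zero]
  · intro h
    refine MvPolynomial.funext fun z => ?_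
    rw [eval_bind₁, polyMap_secantTuple, h, map_zero]

theorem mk_mem_secantVariety_iff {d : ℕ} {x : Fin (d + 1) → ℂ} (hx : x ≠ 0) :
    Projectivization.mk ℂ x hx ∈ secantVariety d ↔ ∀ F ∈ ideal (secantVariety d), eval x F = 0 := by
  rw [ideal_secantVariety]
  exact mk_mem_zariskiClosure_iff hx

theorem rationalNormalCurve_subset_secantVariety {d : ℕ} (hd : 1 ≤ d) :
    rationalNormalCurve d ⊆ secantVariety d :=
  (rationalNormalCurve_subset_secantLines hd).trans (subset_zariskiClosure _)

/-- The action of a matrix on binary forms of degree `d`. -/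
theorem exists_matrix_mulVec_powerVec (d : ℕ) (g : Matrix (Fin 2) (Fin 2) ℂ) :
    ∃ N : Matrix (Fin (d + 1)) (Fin (d + 1)) ℂ, ∀ v,
      N.mulVec (powerVec d v) = powerVec d (g.mulVec v) := by
  have hl : ∀ i, (∑ j, C (g i j) * X j : MvPolynomial (Fin 2) ℂ).IsHomogeneous 1 := fun i =>
    IsHomogeneous.sum _ _ _ fun j _ => by
      simpa using (isHomogeneous_C (Fin 2) (g i j)).mul (isHomogeneous_X ℂ j)
  have hh : ∀ i : Fin (d + 1), ((∑ j, C (g 0 j) * X j : MvPolynomial (Fin 2) ℂ) ^ (d - (i : ℕ)) *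
      (∑ j, C (g 1 j) * X j : MvPolynomial (Fin 2) ℂ) ^ (i : ℕ)).IsHomogeneous d := by
    intro i
    have := ((hl 0).pow (d - (i : ℕ))).mul ((hl 1).pow (i : ℕ))
    rwa [one_mul, one_mul, Nat.sub_add_cancel (by omega)] at this
  choose N hN using fun i => exists_eval_eq_sum_of_isHomogeneous (hh i)
  refine ⟨Matrix.of N, fun v => ?_⟩
  funext i
  have := hN i v
  simp only [map_mul, map_pow, map_sum, eval_C, eval_X] at this
  simp only [powerVec, Matrix.mulVec, dotProduct, Matrix.of_apply]
  rw [← this]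

theorem eq_one_of_mulVec_powerVec {d : ℕ} {N : Matrix (Fin (d + 1)) (Fin (d + 1)) ℂ}
    (h : ∀ v, N.mulVec (powerVec d v) = powerVec d v) : N = 1 := by
  rw [← sub_eq_zero]
  funext i
  refine eq_zero_of_sum_mul_powerVec fun v _ => ?_
  have h1 : (N - 1).mulVec (powerVec d v) = 0 := by
    rw [Matrix.sub_mulVec, h, Matrix.one_mulVec, sub_self]
  exact congrFun h1 i

/-- `N` sends p(a) + p(b) to p(ga) + p(gb), so substituting `N` into a member of the ideal gives a
member of the ideal. -/
theorem mk_mulVec_mem_secantVariety {d : ℕ} (hd : 1 ≤ d) {g : Matrix (Fin 2) (Fin 2) ℂ}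
    {N : Matrix (Fin (d + 1)) (Fin (d + 1)) ℂ}
    (hN : ∀ v, N.mulVec (powerVec d v) = powerVec d (g.mulVec v)) {x : Fin (d + 1) → ℂ}
    (hx : x ≠ 0) (hNx : N.mulVec x ≠ 0) (h : Projectivization.mk ℂ x hx ∈ secantVariety d) :
    Projectivization.mk ℂ (N.mulVec x) hNx ∈ secantVariety d := by
  rw [mk_mem_secantVariety_iff] at h ⊢
  intro F hF
  have hM : ∀ v, polyMap (fun i => ∑ j, C (N i j) * X j) v = N.mulVec v := by
    intro v
    funext i
    simp [Matrix.mulVec, dotProduct]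
  have := h (bind₁ (fun i => ∑ j, C (N i j) * X j) F) (by
    rw [mem_ideal_secantVariety_iff_eval hd] at hF ⊢
    intro a b
    rw [eval_bind₁, hM, Matrix.mulVec_add, hN, hN]
    exact hF _ _)
  rwa [eval_bind₁, hM] at this

/-- Linear automorphisms of the line extend to the secant variety. -/
theorem exists_aut_secantVariety {d : ℕ} (hd : 1 ≤ d) (g : Matrix.GeneralLinearGroup (Fin 2) ℂ) :
    ∃ φ : Aut (secantVariety d), ∀ (v : Fin 2 → ℂ) (hv : v ≠ 0)
      (h : veronese d (Projectivization.mk ℂ v hv) ∈ secantVariety d),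
      (φ.1 ⟨_, h⟩).1 = veronese d (g • Projectivization.mk ℂ v hv) := by
  obtain ⟨N, hN⟩ := exists_matrix_mulVec_powerVec d g.1
  obtain ⟨N', hN'⟩ := exists_matrix_mulVec_powerVec d g⁻¹.1
  -- The product fixes every `powerVec d v`, and these vectors span.
  have h1 : N * N' = 1 := eq_one_of_mulVec_powerVec fun v => by
    rw [← Matrix.mulVec_mulVec, hN', hN, Matrix.mulVec_mulVec, ← Units.val_mul, mul_inv_cancel,
      Units.val_one, Matrix.one_mulVec]
  have h2 : N' * N = 1 := eq_one_of_mulVec_powerVec fun v => by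
    rw [← Matrix.mulVec_mulVec, hN, hN', Matrix.mulVec_mulVec, ← Units.val_mul, inv_mul_cancel,
      Units.val_one, Matrix.one_mulVec]
  let u : Matrix.GeneralLinearGroup (Fin (d + 1)) ℂ := ⟨N, N', h1, h2⟩
  have hu : ∀ p ∈ secantVariety d, u • p ∈ secantVariety d := by
    intro p hp
    induction p using Projectivization.ind with | _ x hx =>
    exact mk_mulVec_mem_secantVariety hd hN hx ((smul_ne_zero_iff_ne u).2 hx) hp
  have hu' : ∀ p ∈ secantVariety d, u⁻¹ • p ∈ secantVariety d := by
    intro p hp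
    induction p using Projectivization.ind with | _ x hx =>
    exact mk_mulVec_mem_secantVariety hd hN' hx ((smul_ne_zero_iff_ne u⁻¹).2 hx) hp
  let φ : Equiv.Perm (secantVariety d) :=
    ⟨fun p => ⟨u • p.1, hu _ p.2⟩, fun p => ⟨u⁻¹ • p.1, hu' _ p.2⟩,
      fun p => Subtype.ext (inv_smul_smul u p.1), fun p => Subtype.ext (smul_inv_smul u p.1)⟩
  refine ⟨⟨φ, isRegularMap_matrix N fun v hv _ => ⟨(smul_ne_zero_iff_ne u).2 hv, rfl⟩,
    isRegularMap_matrix N' fun v hv _ => ⟨(smul_ne_zero_iff_ne u⁻¹).2 hv, rfl⟩⟩, ?_⟩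
  intro v hv h
  change u • veronese d _ = _
  rw [Projectivization.smul_mk, veronese_mk, veronese_mk]
  exact mk_congr (hN v) _ _

end ProjVar

/-! ### Rigidity: regular self-maps that fix the curve pointwise -/

namespace ProjVar

open MvPolynomial

theorem isPrimitiveTuple_powerTuple (d : ℕ) : IsPrimitiveTuple (powerTuple d) :=
  isPrimitiveTuple_of_forall_ne_zero fun v hv => by
    rw [polyMap_powerTuple]
    exact powerVec_ne_zero d hv

/-- A tuple of binary forms without common zeros that describes the Veronese map is the standard
one up to a constant. -/
theorem exists_bind₁_eq_smul_powerVec {d : ℕ} {σ : Type*} (L : σ → MvPolynomial (Fin 2) ℂ)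
    (G : Fin (d + 1) → MvPolynomial σ ℂ)
    (hG : ∀ v (hv : v ≠ 0), ∃ h : polyMap G (polyMap L v) ≠ 0,
      Projectivization.mk ℂ (powerVec d v) (powerVec_ne_zero d hv) = Projectivization.mk ℂ _ h) :
    ∃ c : ℂ, c ≠ 0 ∧ ∀ v, polyMap G (polyMap L v) = c • powerVec d v := by
  have hprim : IsPrimitiveTuple fun j => bind₁ L (G j) :=
    isPrimitiveTuple_of_forall_ne_zero fun v hv => by
      rw [polyMap_bind₁]
      exact (hG v hv).1
  have hX : ∃ z, polyMap (X : Fin 2 → MvPolynomial (Fin 2) ℂ) z ≠ 0 := ⟨1, by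
    rw [polyMap_X]; exact one_ne_zero⟩
  obtain ⟨c, hc, hcG⟩ := (isPrimitiveTuple_powerTuple d).exists_eq_C_mul hprim (by
    intro i j
    refine eq_of_eval_eq_of_polyMap_ne_zero hX fun z hz => ?_
    rw [polyMap_X] at hz
    obtain ⟨h1, h2⟩ := hG z hz
    rw [map_mul, map_mul, ← polyMap_apply (powerTuple d), ← polyMap_apply (powerTuple d),
      polyMap_powerTuple, eval_bind₁, eval_bind₁]
    exact mul_eq_of_mk_eq_mk h2 i j)
  refine ⟨c, hc, fun v => ?_⟩
  rw [← polyMap_bind₁, ← polyMap_powerTuple]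
  funext j
  simp [hcG]

theorem eq_of_smul_powerVec_eq {d : ℕ} {s t : ℂ}
    (h : s • powerVec d ![1, 0] = t • powerVec d ![1, 0]) :
    s = t := by
  have := congrFun h 0
  simpa [powerVec_zero] using this

/-- A polynomial in two pairs of variables that is homogeneous of degree `d`, and all of whose
monomials have degree divisible by `d` in the first pair, is the sum of its two restrictions. -/
theorem eval_eq_add_of_dvd {d : ℕ} (hd : 1 ≤ d) {P : MvPolynomial (Fin 2 ⊕ Fin 2) ℂ}
    (hP : P.IsHomogeneous d)
    (hdvd : ∀ m, coeff m P ≠ 0 → d ∣ m (Sum.inl 0) + m (Sum.inl 1)) (a b : Fin 2 → ℂ) :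
    eval (Sum.elim a b) P = eval (Sum.elim a 0) P + eval (Sum.elim 0 b) P := by
  rw [eval_eq', eval_eq', eval_eq', ← Finset.sum_add_distrib]
  refine Finset.sum_congr rfl fun m hm => ?_
  have hm0 := MvPolynomial.mem_support_iff.mp hm
  rw [← mul_add]
  congr 1
  have hdeg : m (Sum.inl 0) + m (Sum.inl 1) + (m (Sum.inr 0) + m (Sum.inr 1)) = d := by
    have h := hP hm0
    rw [Finsupp.weight_apply, Finsupp.sum_fintype _ _ (by simp), Fintype.sum_sum_type,
      Fin.sum_univ_two, Fin.sum_univ_two] at h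
    simpa using h
  obtain ⟨r, hr⟩ := hdvd m hm0
  simp only [Fintype.prod_sum_type, Fin.prod_univ_two, Sum.elim_inl, Sum.elim_inr, Pi.zero_apply,
    ← pow_add]
  -- The degree `d * r` in the first pair is at most `d`, so each monomial involves only one pair.
  -- As `d ≥ 1`, it vanishes once that pair is set to zero.
  have hr' : r = 0 ∨ r = 1 := by
    rcases r with _ | _ | r
    · exact Or.inl rfl
    · exact Or.inr rfl
    · have : d * (r + 1 + 1) = d * r + d + d := by ring
      have := Nat.zero_le (d * r)
      omega
  rcases hr' with rfl | rfl
  · have h1 : m (Sum.inr 0) + m (Sum.inr 1) ≠ 0 := by omega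
    have h2 : m (Sum.inl 0) = 0 := by omega
    have h3 : m (Sum.inl 1) = 0 := by omega
    simp [h2, h3]
    omega
  · have h1 : m (Sum.inl 0) + m (Sum.inl 1) ≠ 0 := by omega
    have h2 : m (Sum.inr 0) = 0 := by omega
    have h3 : m (Sum.inr 1) = 0 := by omega
    simp [h2, h3]
    omega

theorem polyMap_secantTuple_elim (d : ℕ) (a b : Fin 2 → ℂ) :
    polyMap (secantTuple d) (Sum.elim a b) = powerVec d a + powerVec d b := by
  rw [polyMap_secantTuple]
  rfl

/-- Used at z = (v, 0) and z = (0, v), the two planes that the parametrization maps to the cone over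
the curve. -/
theorem mk_eq_of_fixes_curve {d : ℕ} (hd : 1 ≤ d) {f : secantVariety d → secantVariety d}
    (hfix : ∀ x : secantVariety d, x.1 ∈ rationalNormalCurve d → f x = x)
    {G : Fin (d + 1) → MvPolynomial (Fin 2 ⊕ Fin 2) ℂ} (hG : Represents f (secantTuple d) G)
    {v : Fin 2 → ℂ} (hv : v ≠ 0) {z : Fin 2 ⊕ Fin 2 → ℂ}
    (hz : polyMap (secantTuple d) z = powerVec d v) : ∃ h : polyMap G z ≠ 0,
      Projectivization.mk ℂ (powerVec d v) (powerVec_ne_zero d hv) = Projectivization.mk ℂ _ h := by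
  have h0 : polyMap (secantTuple d) z ≠ 0 := hz ▸ powerVec_ne_zero d hv
  have hmem := mk_polyMap_secantTuple_mem hd z h0
  obtain ⟨h1, h2⟩ := hG z h0 hmem
  refine ⟨h1, ?_⟩
  have h3 := mk_congr hz h0 (powerVec_ne_zero d hv)
  rw [← h2, hfix ⟨_, hmem⟩ (by
    change Projectivization.mk ℂ _ h0 ∈ _
    rw [h3]
    exact mk_powerVec_mem d hv _)]
  exact h3.symm

/-- A regular self-map of the secant variety that fixes the curve pointwise lifts, up to a
constant, to the identity of the parameter space. -/
theorem exists_represents_smul_of_fixes_curve {d : ℕ} (hd : 1 ≤ d)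
    {f : secantVariety d → secantVariety d} (hf : IsRegularMap f)
    (hfix : ∀ x : secantVariety d, x.1 ∈ rationalNormalCurve d → f x = x) :
    ∃ (G : Fin (d + 1) → MvPolynomial (Fin 2 ⊕ Fin 2) ℂ) (c : ℂ), Represents f (secantTuple d) G ∧
      ∀ a b, polyMap G (Sum.elim a b) = c • (powerVec d a + powerVec d b) := by
  have hΨ := exists_polyMap_secantTuple_ne_zero d
  have hΨX := mk_polyMap_secantTuple_mem hd
  obtain ⟨G, hGp, hG⟩ := hf.exists_represents hΨ hΨX
  have hl : ∀ v, polyMap (Sum.elim X 0 : Fin 2 ⊕ Fin 2 → MvPolynomial (Fin 2) ℂ) v =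
      Sum.elim v 0 := by
    intro v
    funext i
    rcases i with i | i <;> simp
  have hr : ∀ v, polyMap (Sum.elim 0 X : Fin 2 ⊕ Fin 2 → MvPolynomial (Fin 2) ℂ) v =
      Sum.elim (0 : Fin 2 → ℂ) v := by
    intro v
    funext i
    rcases i with i | i <;> simp
  obtain ⟨c, hc, hcG⟩ := exists_bind₁_eq_smul_powerVec (Sum.elim X 0) G fun v hv =>
    mk_eq_of_fixes_curve hd hfix hG hv (by
      rw [hl, polyMap_secantTuple_elim, powerVec_zero_vec hd, add_zero])
  obtain ⟨c', hc', hcG'⟩ := exists_bind₁_eq_smul_powerVec (Sum.elim 0 X) G fun v hv =>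
    mk_eq_of_fixes_curve hd hfix hG hv (by
      rw [hr, polyMap_secantTuple_elim, powerVec_zero_vec hd, zero_add])
  simp only [hl] at hcG
  simp only [hr] at hcG'
  -- The eigenvalue is read off at the point ((1, 0), 0), where `G` is `c` times the monomial
  -- vector; only the scaling of the first pair matters there.
  have hscale : ∀ (s : Fin 2 ⊕ Fin 2 → ℂˣ) (t χ : ℂ), (∀ i, (s (Sum.inl i) : ℂ) = t) →
      (∀ j, scaleVars s (G j) = C χ * G j) → χ = t ^ d := by
    intro s t χ hs h
    have h1 : polyMap G (Sum.elim (t • ![1, 0]) 0) = χ • polyMap G (Sum.elim ![1, 0] 0) := by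
      funext j
      have := congrArg (eval (Sum.elim ![1, 0] 0)) (h j)
      rw [eval_scaleVars, map_mul, eval_C] at this
      rw [Pi.smul_apply, polyMap_apply, polyMap_apply, smul_eq_mul, ← this]
      congr 2
      funext i
      rcases i with i | i
      · simp only [hs, Sum.elim_inl, Pi.smul_apply, smul_eq_mul]
      · simp
    rw [hcG, hcG, powerVec_smul, smul_smul, smul_smul] at h1
    have := eq_of_smul_powerVec_eq h1
    exact (mul_left_cancel₀ hc (by rw [this, mul_comm])).symm
  obtain ⟨χ, -, hχ⟩ := hG.exists_scaleVars_eq hΨ hΨX hGp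
    (fun _ => Units.mk0 (2 : ℂ) two_ne_zero) (a := 2 ^ d) (pow_ne_zero _ two_ne_zero) (fun z => by
      rw [polyMap_secantTuple, polyMap_secantTuple, smul_add, ← powerVec_smul, ← powerVec_smul]
      rfl)
  obtain ⟨k, hk, hhom⟩ := exists_isHomogeneous_of_scaleVars_eq hχ hGp.exists_ne_zero
  have hkd : k = d := by
    have h1 := hk.symm.trans (hscale _ 2 χ (fun i => rfl) hχ)
    have : (2 : ℕ) ^ k = 2 ^ d := by exact_mod_cast h1
    exact Nat.pow_right_injective le_rfl this
  subst hkd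
  -- From here on `k` is the degree of the curve. Multiplying the first pair by ζ does not change
  -- the parametrization and has eigenvalue ζ ^ k = 1, so every monomial of `G` has degree divisible
  -- by `k` in that pair.
  have hζ := Complex.isPrimitiveRoot_exp k (by omega)
  set ζ := Complex.exp (2 * Real.pi * Complex.I / k)
  have hζ0 : ζ ≠ 0 := hζ.ne_zero (by omega)
  let s : Fin 2 ⊕ Fin 2 → ℂˣ := Sum.elim (fun _ => Units.mk0 ζ hζ0) (fun _ => 1)
  obtain ⟨η, -, hη⟩ := hG.exists_scaleVars_eq hΨ hΨX hGp s (a := 1) one_ne_zero (fun z => by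
      have h1 : (fun i => (s i : ℂ) * z i) ∘ Sum.inl = ζ • (z ∘ Sum.inl) := rfl
      have h2 : (fun i => (s i : ℂ) * z i) ∘ Sum.inr = z ∘ Sum.inr := by
        funext i
        simp [s]
      rw [polyMap_secantTuple, polyMap_secantTuple, h1, h2, powerVec_smul, hζ.pow_eq_one, one_smul,
        one_smul])
  have hη1 : η = 1 := by rw [hscale s ζ η (fun i => rfl) hη, hζ.pow_eq_one]
  have hsum : ∀ a b, polyMap G (Sum.elim a b) = c • powerVec k a + c' • powerVec k b := by
    intro a b
    rw [← hcG, ← hcG']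
    funext j
    refine eval_eq_add_of_dvd hd (hhom j) (fun m hm => ?_) a b
    have h1 := congrArg (coeff m) (hη j)
    rw [coeff_scaleVars, coeff_C_mul, hη1] at h1
    have h2 := mul_right_cancel₀ hm h1
    rw [Finsupp.prod_fintype _ _ (by simp), Fintype.prod_sum_type] at h2
    simp only [s, Sum.elim_inl, Sum.elim_inr, Units.val_mk0, Units.val_one, one_pow,
      Finset.prod_const_one, mul_one, Fin.prod_univ_two, ← pow_add] at h2
    exact (hζ.pow_eq_one_iff_dvd _).1 h2
  have hcc : c' = c := by
    by_contra hne
    -- With t ^ k = -c / c' the tuple `G` vanishes at (e, t e), e = (1, 0), while the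
    -- parametrization there is (1 - c / c') p(e) ≠ 0. This contradicts `Represents`.
    obtain ⟨t, ht⟩ := IsAlgClosed.exists_pow_nat_eq (-c / c') (show 0 < k by omega)
    have h1 : polyMap (secantTuple k) (Sum.elim ![1, 0] (t • ![1, 0])) ≠ 0 := by
      rw [polyMap_secantTuple_elim, powerVec_smul, ht]
      intro h0
      have := congrFun h0 0
      simp [powerVec_zero] at this
      field_simp at this
      exact hne (by linear_combination this)
    apply (hG _ h1 (hΨX _ h1)).1
    rw [hsum, powerVec_smul, ht, smul_smul, mul_div_cancel₀ _ hc', neg_smul, add_neg_cancel]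
  subst hcc
  exact ⟨G, c', hG, fun a b => by rw [hsum, smul_add]⟩

/-- A regular self-map of the secant variety that fixes the curve pointwise is the identity. -/
theorem eq_self_of_fixes_curve {d : ℕ} (hd : 1 ≤ d)
    {f : secantVariety d → secantVariety d} (hf : IsRegularMap f)
    (hfix : ∀ x : secantVariety d, x.1 ∈ rationalNormalCurve d → f x = x)
    (x : secantVariety d) : f x = x := by
  obtain ⟨G, c, hG, hGc⟩ := exists_represents_smul_of_fixes_curve hd hf hfix
  have hsec : ∀ (v : Fin (d + 1) → ℂ) (hv : v ≠ 0) (h : Projectivization.mk ℂ v hv ∈ secantLines d),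
      (f ⟨_, subset_zariskiClosure _ h⟩).1 = Projectivization.mk ℂ v hv := by
    intro v hv h
    obtain ⟨a, b, rfl⟩ := exists_powerVec_add_of_mem hd h
    have h1 := polyMap_secantTuple_elim d a b
    have h2 : polyMap (secantTuple d) (Sum.elim a b) ≠ 0 := h1 ▸ hv
    obtain ⟨h3, h4⟩ := hG _ h2 (mk_polyMap_secantTuple_mem hd _ h2)
    rw [mk_congr (hGc a b) h3 (hGc a b ▸ h3), mk_smul _ hv] at h4
    refine Eq.trans ?_ h4
    congr 2
    exact Subtype.ext (mk_congr h1.symm _ _)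
  obtain ⟨x, hx⟩ := x
  induction x using Projectivization.ind with | _ v hv =>
  obtain ⟨k, F, -, -, hFv, hF⟩ := hf.exists_polyMap v hv hx
  refine Subtype.ext ?_
  rw [hF v hv hx hFv]
  refine mk_eq_mk_of_mul_eq hFv hv fun i j => ?_
  -- That F(x) is proportional to x is a polynomial condition: it holds on the secant lines,
  -- trivially where `F` vanishes, and passes to the closure.
  have hmem : F i * X j - F j * X i ∈ ideal (secantLines d) := by
    rw [mem_ideal_iff]
    intro w hw hwX
    simp only [map_sub, map_mul, eval_X]
    by_cases h0 : polyMap F w = 0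
    · have hi := congrFun h0 i
      have hj := congrFun h0 j
      simp only [polyMap_apply, Pi.zero_apply] at hi hj
      rw [hi, hj]
      ring
    · have h1 := (hF w hw (subset_zariskiClosure _ hwX) h0).symm.trans (hsec w hw hwX)
      exact sub_eq_zero.2 (mul_eq_of_mk_eq_mk h1 i j)
  have := (mk_mem_zariskiClosure_iff hv).1 hx _ hmem
  simpa [sub_eq_zero] using this

end ProjVar

/-! ### Tangent spaces and their invariance under isomorphisms -/

namespace ProjVar

open MvPolynomial

variable {ι κ : Type*} [Fintype ι]

/-- The derivative of a polynomial at `v` in the direction `w`. -/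
def dirDeriv (v w : ι → ℂ) (F : MvPolynomial ι ℂ) : ℂ := ∑ i, eval v (pderiv i F) * w i

theorem dirDeriv_add (v w : ι → ℂ) (F G : MvPolynomial ι ℂ) :
    dirDeriv v w (F + G) = dirDeriv v w F + dirDeriv v w G := by
  simp [dirDeriv, add_mul, Finset.sum_add_distrib]

theorem dirDeriv_sub (v w : ι → ℂ) (F G : MvPolynomial ι ℂ) :
    dirDeriv v w (F - G) = dirDeriv v w F - dirDeriv v w G := by
  simp [dirDeriv, sub_mul, Finset.sum_sub_distrib]

theorem dirDeriv_mul (v w : ι → ℂ) (F G : MvPolynomial ι ℂ) :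
    dirDeriv v w (F * G) = dirDeriv v w F * eval v G + eval v F * dirDeriv v w G := by
  simp only [dirDeriv, pderiv_mul, map_add, map_mul, add_mul, Finset.sum_add_distrib,
    Finset.sum_mul, Finset.mul_sum]
  congr 1 <;> exact Finset.sum_congr rfl fun i _ => by ring

theorem dirDeriv_C (v w : ι → ℂ) (a : ℂ) : dirDeriv v w (C a) = 0 := by
  simp [dirDeriv]

theorem dirDeriv_C_mul (v w : ι → ℂ) (a : ℂ) (F : MvPolynomial ι ℂ) :
    dirDeriv v w (C a * F) = a * dirDeriv v w F := by
  rw [dirDeriv_mul, dirDeriv_C, zero_mul, zero_add, eval_C]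

theorem dirDeriv_X (v w : ι → ℂ) (i : ι) : dirDeriv v w (X i) = w i := by
  classical
  simp [dirDeriv, pderiv_X, Pi.single_apply, apply_ite (eval v)]

/-- The chain rule. -/
theorem dirDeriv_bind₁ [Fintype κ] (v w : ι → ℂ) (F : κ → MvPolynomial ι ℂ)
    (P : MvPolynomial κ ℂ) :
    dirDeriv v w (bind₁ F P) = dirDeriv (polyMap F v) (fun j => dirDeriv v w (F j)) P := by
  induction P using MvPolynomial.induction_on with
  | C a => rw [bind₁_C_right, dirDeriv_C, dirDeriv_C]
  | add p q hp hq => rw [map_add, dirDeriv_add, dirDeriv_add, hp, hq]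
  | mul_X p i hp =>
    rw [map_mul, dirDeriv_mul, dirDeriv_mul, hp, bind₁_X_right, dirDeriv_X, eval_bind₁, eval_X,
      polyMap_apply]

theorem dirDeriv_zero_right (v : ι → ℂ) (F : MvPolynomial ι ℂ) : dirDeriv v 0 F = 0 := by
  simp [dirDeriv]

theorem dirDeriv_smul_right (v w : ι → ℂ) (a : ℂ) (F : MvPolynomial ι ℂ) :
    dirDeriv v (a • w) F = a * dirDeriv v w F := by
  simp only [dirDeriv, Pi.smul_apply, smul_eq_mul, Finset.mul_sum]
  exact Finset.sum_congr rfl fun i _ => by ring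

/-- Euler's identity. -/
theorem dirDeriv_self {k : ℕ} {F : MvPolynomial ι ℂ} (hF : F.IsHomogeneous k) (v : ι → ℂ) :
    dirDeriv v v F = k * eval v F := by
  have := congrArg (eval v) hF.sum_X_mul_pderiv
  simp only [map_sum, map_mul, eval_X, nsmul_eq_mul, map_natCast] at this
  rw [← this]
  exact Finset.sum_congr rfl fun i _ => mul_comm _ _

/-- The Zariski tangent space of the affine cone over `X` at a vector. -/
def tangentAt (X : Set (ℙ ℂ (ι → ℂ))) (v : ι → ℂ) : Submodule ℂ (ι → ℂ) where
  carrier := {w | ∀ F ∈ ideal X, dirDeriv v w F = 0}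
  zero_mem' := fun F _ => dirDeriv_zero_right v F
  add_mem' := by
    intro a b ha hb F hF
    have h1 := ha F hF
    have h2 := hb F hF
    simp only [dirDeriv] at h1 h2
    simp [dirDeriv, mul_add, Finset.sum_add_distrib, h1, h2]
  smul_mem' := fun a w hw F hF => by rw [dirDeriv_smul_right, hw F hF, mul_zero]

theorem coneTangentSpace_eq (X : Set (ℙ ℂ (ι → ℂ))) (p : ℙ ℂ (ι → ℂ)) :
    coneTangentSpace X p = tangentAt X p.rep := rfl

/-- The ideal is stable under the substitution `u ↦ a • u`, and the chain rule multiplies the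
derivative by `a`. -/
theorem tangentAt_le_tangentAt_smul (X : Set (ℙ ℂ (ι → ℂ))) (v : ι → ℂ) {a : ℂ} (ha : a ≠ 0) :
    tangentAt X v ≤ tangentAt X (a • v) := by
  intro w hw F hF
  have hM : ∀ u : ι → ℂ, polyMap (fun i => C a * MvPolynomial.X i) u = a • u := by
    intro u
    funext i
    simp
  have h := hw (bind₁ (fun i => C a * MvPolynomial.X i) F) (by
    rw [mem_ideal_iff] at hF ⊢
    intro u hu huX
    rw [eval_bind₁, hM]
    exact hF _ (smul_ne_zero ha hu) (by rwa [mk_smul]))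
  rw [dirDeriv_bind₁, hM] at h
  have h1 : (fun j => dirDeriv v w (C a * MvPolynomial.X j)) = a • w := by
    funext j
    rw [dirDeriv_C_mul, dirDeriv_X]
    rfl
  rw [h1, dirDeriv_smul_right] at h
  exact (mul_eq_zero.1 h).resolve_left ha

theorem tangentAt_smul (X : Set (ℙ ℂ (ι → ℂ))) (v : ι → ℂ) {a : ℂ} (ha : a ≠ 0) :
    tangentAt X (a • v) = tangentAt X v := by
  refine le_antisymm ?_ (tangentAt_le_tangentAt_smul X v ha)
  have := tangentAt_le_tangentAt_smul X (a • v) (inv_ne_zero ha)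
  rwa [inv_smul_smul₀ ha] at this

theorem coneTangentSpace_mk (X : Set (ℙ ℂ (ι → ℂ))) (v : ι → ℂ) (hv : v ≠ 0) :
    coneTangentSpace X (Projectivization.mk ℂ v hv) = tangentAt X v := by
  obtain ⟨a, ha, h⟩ := exists_rep_eq_smul v hv
  rw [coneTangentSpace_eq, h, tangentAt_smul X v ha]

/-- The differential of a polynomial map. -/
def polyDeriv (F : κ → MvPolynomial ι ℂ) (v : ι → ℂ) : (ι → ℂ) →ₗ[ℂ] (κ → ℂ) :=
  Matrix.mulVecLin (Matrix.of fun j i => eval v (pderiv i (F j)))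

theorem polyDeriv_apply (F : κ → MvPolynomial ι ℂ) (v w : ι → ℂ) :
    polyDeriv F v w = fun j => dirDeriv v w (F j) := rfl

/-- An isomorphism does not lower the dimension of tangent spaces. -/
theorem finrank_coneTangentSpace_le [Fintype κ] {X : Set (ℙ ℂ (ι → ℂ))} {Y : Set (ℙ ℂ (κ → ℂ))}
    {f : X → Y} {g : Y → X} (hf : IsRegularMap f) (hg : IsRegularMap g) (hgf : ∀ x, g (f x) = x)
    (p : X) : Module.finrank ℂ (coneTangentSpace X p.1) ≤
      Module.finrank ℂ (coneTangentSpace Y (f p).1) := by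
  obtain ⟨p, hp⟩ := p
  induction p using Projectivization.ind with | _ v hv =>
  obtain ⟨k, F, hk, hFk, hFv, hF⟩ := hf.exists_polyMap v hv hp
  have hfp := hF v hv hp hFv
  have hu : Projectivization.mk ℂ (polyMap F v) hFv ∈ Y := hfp ▸ (f ⟨_, hp⟩).2
  obtain ⟨l, G, -, hGl, hGu, hG⟩ := hg.exists_polyMap _ hFv hu
  rw [hfp, coneTangentSpace_mk, coneTangentSpace_mk]
  obtain ⟨j₀, hj₀⟩ := Function.ne_iff.mp hFv
  have hj₀' : eval v (F j₀) ≠ 0 := hj₀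
  have hmap : ∀ w ∈ tangentAt X v, polyDeriv F v w ∈ tangentAt Y (polyMap F v) := by
    intro w hw H hH
    -- The factor `F j₀` forces vanishing where the formula for `f` breaks down. It is nonzero at
    -- `v`, so it cancels after differentiation.
    have hmem : F j₀ * bind₁ F H ∈ ideal X := by
      rw [mem_ideal_iff]
      intro x hx hxX
      rw [map_mul, eval_bind₁]
      by_cases h0 : polyMap F x = 0
      · have := congrFun h0 j₀
        rw [polyMap_apply, Pi.zero_apply] at this
        rw [this, zero_mul]
      · have h1 := hF x hx hxX h0
        rw [mem_ideal_iff.1 hH _ h0 (h1 ▸ (f _).2), mul_zero]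
    have h := hw _ hmem
    rw [dirDeriv_mul, eval_bind₁, mem_ideal_iff.1 hH _ hFv hu, mul_zero, zero_add,
      dirDeriv_bind₁] at h
    exact (mul_eq_zero.1 h).resolve_left hj₀'
  -- Differentiating the relations `G i (F x) * x j = G j (F x) * x i`, which say that g undoes f,
  -- along a `w` killed by the differential shows that `w` is a multiple of `v`. By Euler's identity
  -- the differential sends `v` to `k • F v ≠ 0`, so `w = 0`.
  have hinj : ∀ w ∈ tangentAt X v, polyDeriv F v w = 0 → w = 0 := by
    intro w hw hw0
    have hback : ∀ (x : ι → ℂ) (hx : x ≠ 0) (_ : Projectivization.mk ℂ x hx ∈ X)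
        (_ : polyMap F x ≠ 0) (_ : polyMap G (polyMap F x) ≠ 0) (i j : ι),
        eval (polyMap F x) (G i) * x j = eval (polyMap F x) (G j) * x i := by
      intro x hx hxX h0 h1 i j
      have h2 := hF x hx hxX h0
      have h3 : Projectivization.mk ℂ (polyMap F x) h0 ∈ Y := h2 ▸ (f ⟨_, hxX⟩).2
      have h4 := hG _ h0 h3 h1
      have h5 : f ⟨_, hxX⟩ = ⟨_, h3⟩ := Subtype.ext h2
      rw [← h5, hgf] at h4
      exact mul_eq_of_mk_eq_mk h4.symm i j
    have hprop : ∀ i j, eval (polyMap F v) (G i) * w j = eval (polyMap F v) (G j) * w i := by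
      intro i j
      have hmem : F j₀ * (bind₁ F (G i) * MvPolynomial.X j - bind₁ F (G j) * MvPolynomial.X i) ∈
          ideal X := by
        rw [mem_ideal_iff]
        intro x hx hxX
        simp only [map_mul, map_sub, eval_bind₁, eval_X]
        by_cases h0 : polyMap F x = 0
        · have := congrFun h0 j₀
          rw [polyMap_apply, Pi.zero_apply] at this
          rw [this, zero_mul]
        by_cases h1 : polyMap G (polyMap F x) = 0
        · have hi := congrFun h1 i
          have hj := congrFun h1 j
          rw [polyMap_apply, Pi.zero_apply] at hi hj
          rw [hi, hj]
          ring
        · rw [hback x hx hxX h0 h1 i j, sub_self, mul_zero]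
      have h := hw _ hmem
      have hz : (fun j => dirDeriv v w (F j)) = 0 := hw0
      have hz' : dirDeriv v w (F j₀) = 0 := congrFun hz j₀
      simp only [dirDeriv_mul, dirDeriv_sub, dirDeriv_bind₁, hz, hz', dirDeriv_zero_right,
        dirDeriv_X, eval_bind₁, zero_mul, zero_add] at h
      exact sub_eq_zero.1 ((mul_eq_zero.1 h).resolve_left hj₀')
    obtain ⟨i₀, hi₀⟩ := Function.ne_iff.mp hGu
    have hi₀' : eval (polyMap F v) (G i₀) ≠ 0 := hi₀
    have hvi : v i₀ ≠ 0 := by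
      intro h0
      refine hv (funext fun j => ?_)
      have := hback v hv hp hFv hGu i₀ j
      rw [h0, mul_zero] at this
      exact (mul_eq_zero.1 this).resolve_left hi₀'
    have hwv : w = (w i₀ / v i₀) • v := by
      funext j
      have h1 := hprop i₀ j
      have h2 := hback v hv hp hFv hGu i₀ j
      rw [Pi.smul_apply, smul_eq_mul, div_mul_eq_mul_div, eq_div_iff hvi]
      refine mul_left_cancel₀ hi₀' ?_
      linear_combination v i₀ * h1 - w i₀ * h2
    have h := congrFun hw0 j₀
    rw [polyDeriv_apply, hwv] at h
    change dirDeriv v (_ • v) (F j₀) = 0 at h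
    rw [dirDeriv_smul_right, dirDeriv_self (hFk j₀)] at h
    have hk' : (k : ℂ) ≠ 0 := by exact_mod_cast hk.ne'
    rw [hwv, (mul_eq_zero.1 h).resolve_right (mul_ne_zero hk' hj₀'), zero_smul]
  refine LinearMap.finrank_le_finrank_of_injective
    (f := (polyDeriv F v).restrict hmap) ?_
  rw [← LinearMap.ker_eq_bot, LinearMap.ker_eq_bot']
  rintro ⟨w, hw⟩ h
  exact Subtype.ext (hinj w hw (congrArg Subtype.val h))

/-- Automorphisms preserve the singular locus. -/
theorem mem_singularLocus_of_mem {X : Set (ℙ ℂ (ι → ℂ))} (φ : Aut X) {x : X}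
    (hx : x.1 ∈ singularLocus X) : (φ.1 x).1 ∈ singularLocus X :=
  ⟨(φ.1 x).2, hx.2.trans_le (by
    exact_mod_cast finrank_coneTangentSpace_le φ.2.1 φ.2.2 φ.1.symm_apply_apply x)⟩

end ProjVar

/-! ### Dimension and singular locus of the secant variety -/

namespace ProjVar

open MvPolynomial

/-- A polynomial in four variables that vanishes on all sums of two points of the cone over the
twisted cubic is zero. -/
theorem eq_zero_of_eval_cubic_sums {P : MvPolynomial (Fin 4) ℂ}
    (h : ∀ α β x y : ℂ, eval (fun i : Fin 4 => α * x ^ (i : ℕ) + β * y ^ (i : ℕ)) P = 0) :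
    P = 0 := by
  -- Where `D ≠ 0`, Cramer's rule yields e₁, e₂ with c₂ = e₁ c₁ - e₂ c₀ and c₃ = e₁ c₂ - e₂ c₁. Then
  -- `E` is D² times the discriminant of T² - e₁ T + e₂, so `E ≠ 0` makes its roots distinct.
  let D : MvPolynomial (Fin 4) ℂ := X 1 ^ 2 - X 0 * X 2
  let E : MvPolynomial (Fin 4) ℂ := (X 1 * X 2 - X 0 * X 3) ^ 2 -
    4 * (X 2 ^ 2 - X 1 * X 3) * (X 1 ^ 2 - X 0 * X 2)
  have hD : ∀ c, eval c D = c 1 ^ 2 - c 0 * c 2 := fun c => by simp [D]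
  have hE : ∀ c, eval c E = (c 1 * c 2 - c 0 * c 3) ^ 2 -
      4 * (c 2 ^ 2 - c 1 * c 3) * (c 1 ^ 2 - c 0 * c 2) := fun c => by simp [E]
  refine eq_of_eval_eq_of_polyMap_ne_zero (Ψ := fun _ : Unit => D * E) ⟨![1, 0, -1, 0], ?_⟩ ?_
  · refine Function.ne_iff.2 ⟨(), ?_⟩
    rw [polyMap_apply, map_mul, hD, hE]
    simp
  · intro c hc
    obtain ⟨u, hc'⟩ := Function.ne_iff.1 hc
    rw [polyMap_apply, map_mul, hD, hE, Pi.zero_apply] at hc'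
    have hD0 := left_ne_zero_of_mul hc'
    have hE0 := right_ne_zero_of_mul hc'
    obtain ⟨e₁, he₁⟩ : ∃ e, e * (c 1 ^ 2 - c 0 * c 2) = c 1 * c 2 - c 0 * c 3 :=
      ⟨_, div_mul_cancel₀ _ hD0⟩
    obtain ⟨e₂, he₂⟩ : ∃ e, e * (c 1 ^ 2 - c 0 * c 2) = c 2 ^ 2 - c 1 * c 3 :=
      ⟨_, div_mul_cancel₀ _ hD0⟩
    have h2 : c 2 = e₁ * c 1 - e₂ * c 0 := by
      refine mul_right_cancel₀ hD0 ?_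
      linear_combination c 0 * he₂ - c 1 * he₁
    have h3 : c 3 = e₁ * c 2 - e₂ * c 1 := by
      refine mul_right_cancel₀ hD0 ?_
      linear_combination c 1 * he₂ - c 2 * he₁
    obtain ⟨δ, hδ⟩ := IsAlgClosed.exists_pow_nat_eq (e₁ ^ 2 - 4 * e₂) (show 0 < 2 by norm_num)
    have hδ0 : δ ≠ 0 := by
      rintro rfl
      apply hE0
      linear_combination (-(c 1 * c 2 - c 0 * c 3) - e₁ * (c 1 ^ 2 - c 0 * c 2)) * he₁ +
        4 * (c 1 ^ 2 - c 0 * c 2) * he₂ - (c 1 ^ 2 - c 0 * c 2) ^ 2 * hδ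
    let x := (e₁ + δ) / 2
    let y := (e₁ - δ) / 2
    have hx : x ^ 2 = e₁ * x - e₂ := by
      simp only [x]
      linear_combination hδ / 4
    have hy : y ^ 2 = e₁ * y - e₂ := by
      simp only [y]
      linear_combination hδ / 4
    have hxy : x - y = δ := by
      simp only [x, y]
      ring
    -- Cramer's rule for α + β = c₀ and αx + βy = c₁; the recurrence then yields the other two
    -- coordinates.
    obtain ⟨α, hα⟩ : ∃ a, a * δ = c 1 - c 0 * y := ⟨_, div_mul_cancel₀ _ hδ0⟩
    obtain ⟨β, hβ⟩ : ∃ a, a * δ = c 0 * x - c 1 := ⟨_, div_mul_cancel₀ _ hδ0⟩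
    have h0' : α + β = c 0 := by
      refine mul_right_cancel₀ hδ0 ?_
      linear_combination hα + hβ + c 0 * hxy
    have h1' : α * x + β * y = c 1 := by
      refine mul_right_cancel₀ hδ0 ?_
      linear_combination x * hα + y * hβ + c 1 * hxy
    have h2' : α * x ^ 2 + β * y ^ 2 = c 2 := by
      rw [h2]
      linear_combination α * hx + β * hy + e₁ * h1' - e₂ * h0'
    have h3' : α * x ^ 3 + β * y ^ 3 = c 3 := by
      rw [h3]
      linear_combination α * x * hx + β * y * hy + e₁ * h2' - e₂ * h1'
    rw [map_zero, ← h α β x y]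
    congr 2
    funext i
    fin_cases i
    · simp [h0']
    · simp [h1']
    · simp [h2']
    · simp [h3']

/-- The affine cone over the secant variety has dimension four. -/
theorem trdeg_secantVariety {d : ℕ} (hd : 3 ≤ d) :
    Algebra.trdeg ℂ (MvPolynomial (Fin (d + 1)) ℂ ⧸ ideal (secantVariety d)) = 4 := by
  have hd1 : 1 ≤ d := by omega
  refine le_antisymm ?_ ?_
  · let f := Ideal.Quotient.liftₐ (ideal (secantVariety d)) (bind₁ (secantTuple d))
      fun F hF => (mem_ideal_secantVariety hd1).1 hF
    have hf : Function.Injective f := by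
      rw [injective_iff_map_eq_zero]
      intro F hF
      obtain ⟨F, rfl⟩ := Ideal.Quotient.mk_surjective F
      exact Ideal.Quotient.eq_zero_iff_mem.2 ((mem_ideal_secantVariety hd1).2 hF)
    refine (trdeg_le_of_injective f hf).trans ?_
    rw [MvPolynomial.trdeg_of_isDomain]
    simp
  -- At α p(1, x) + β p(1, y) the first four coordinates are α xⁱ + β yⁱ, so a relation between them
  -- vanishes on all sums of two points of the cone over the twisted cubic.
  · have hx : AlgebraicIndependent ℂ fun i : Fin 4 =>
        Ideal.Quotient.mk (ideal (secantVariety d)) (X (Fin.castLE (by omega) i)) := by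
      rw [algebraicIndependent_iff]
      intro P hP
      have h1 : aeval (fun i : Fin 4 => Ideal.Quotient.mk (ideal (secantVariety d))
          (X (Fin.castLE (by omega) i))) = (Ideal.Quotient.mkₐ ℂ (ideal (secantVariety d))).comp
          (rename (Fin.castLE (show 4 ≤ d + 1 by omega))) := by
        ext i
        simp
      rw [h1, AlgHom.comp_apply, Ideal.Quotient.mkₐ_eq_mk, Ideal.Quotient.eq_zero_iff_mem,
        mem_ideal_secantVariety_iff_eval hd1] at hP
      refine eq_zero_of_eval_cubic_sums fun α β x y => ?_
      obtain ⟨a, ha⟩ := exists_smul_powerVec_eq hd1 α ![1, x]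
      obtain ⟨b, hb⟩ := exists_smul_powerVec_eq hd1 β ![1, y]
      rw [← hP a b, eval_rename, ← ha, ← hb]
      congr 2
      funext i
      simp [powerVec]
    have := hx.cardinalMk_le_trdeg
    simpa using this

/-- Along the line `F` becomes the zero polynomial in `t`; by the chain rule its derivative at 0 is
the directional derivative. -/
theorem dirDeriv_eq_zero_of_line {ι : Type*} [Fintype ι] {F : MvPolynomial ι ℂ} {v w : ι → ℂ}
    (h : ∀ t : ℂ, eval (v + t • w) F = 0) : dirDeriv v w F = 0 := by
  let L : ι → MvPolynomial Unit ℂ := fun i => C (v i) + C (w i) * X ()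
  have hL : ∀ t, polyMap L t = v + t () • w := by
    intro t
    funext i
    simp [L, mul_comm]
  have h0 : bind₁ L F = 0 := MvPolynomial.funext fun t => by
    rw [eval_bind₁, hL, h, map_zero]
  have h1 := dirDeriv_bind₁ 0 1 L F
  rw [h0, hL] at h1
  have h2 : (fun j => dirDeriv (0 : Unit → ℂ) 1 (L j)) = w := by
    funext i
    simp [L, dirDeriv_add, dirDeriv_C, dirDeriv_C_mul, dirDeriv_X]
  rw [h2, Pi.zero_apply, zero_smul, add_zero] at h1
  rw [← h1]
  simp [dirDeriv]

/-- At the points of the curve the tangent space is the whole space. -/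
theorem tangentAt_powerVec {d : ℕ} (hd : 1 ≤ d) (v : Fin 2 → ℂ) :
    tangentAt (secantVariety d) (powerVec d v) = ⊤ := by
  -- Every vector p(v) + t p(w) is again a sum of two monomial vectors, so all p(w) are tangent.
  refine eq_top_of_powerVec_mem fun w _ F hF => dirDeriv_eq_zero_of_line fun t => ?_
  obtain ⟨u, hu⟩ := exists_smul_powerVec_eq hd t w
  rw [hu]
  exact (mem_ideal_secantVariety_iff_eval hd).1 hF v u

/-- The coordinates of a vector, continued by zero. -/
def coord {d : ℕ} (x : Fin (d + 1) → ℂ) (n : ℕ) : ℂ := if h : n < d + 1 then x ⟨n, h⟩ else 0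

/-- The variables, continued by zero. -/
def coordVar (d n : ℕ) : MvPolynomial (Fin (d + 1)) ℂ := if h : n < d + 1 then X ⟨n, h⟩ else 0

theorem eval_coordVar {d : ℕ} (x : Fin (d + 1) → ℂ) (n : ℕ) :
    eval x (coordVar d n) = coord x n := by
  unfold coordVar coord
  split_ifs <;> simp

theorem dirDeriv_coordVar {d : ℕ} (x w : Fin (d + 1) → ℂ) (n : ℕ) :
    dirDeriv x w (coordVar d n) = coord w n := by
  unfold coordVar coord
  split_ifs
  · exact dirDeriv_X _ _ _
  · simp [dirDeriv]

theorem coord_val {d : ℕ} (x : Fin (d + 1) → ℂ) (i : Fin (d + 1)) : coord x i = x i := by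
  rw [coord, dif_pos i.isLt]

theorem coord_add {d : ℕ} (x y : Fin (d + 1) → ℂ) (n : ℕ) :
    coord (x + y) n = coord x n + coord y n := by
  unfold coord
  split_ifs <;> simp

theorem coord_smul {d : ℕ} (a : ℂ) (x : Fin (d + 1) → ℂ) (n : ℕ) :
    coord (a • x) n = a * coord x n := by
  unfold coord
  split_ifs <;> simp

theorem coord_powerVec {d n : ℕ} (h : n ≤ d) (v : Fin 2 → ℂ) :
    coord (powerVec d v) n = v 0 ^ (d - n) * v 1 ^ n := by
  rw [coord, dif_pos (by omega)]
  rfl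

/-- The coordinates of the cross product of two rows of the Hankel matrix with three columns. -/
def hankelCross (d i j : ℕ) : Fin 3 → MvPolynomial (Fin (d + 1)) ℂ :=
  ![coordVar d (i + 1) * coordVar d (j + 2) - coordVar d (i + 2) * coordVar d (j + 1),
    coordVar d (i + 2) * coordVar d j - coordVar d i * coordVar d (j + 2),
    coordVar d i * coordVar d (j + 1) - coordVar d (i + 1) * coordVar d j]

/-- The maximal minors of the Hankel matrix with three columns. -/
def hankelMinor (d i j k : ℕ) : MvPolynomial (Fin (d + 1)) ℂ :=
  hankelCross d i j 0 * coordVar d k + hankelCross d i j 1 * coordVar d (k + 1) +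
    hankelCross d i j 2 * coordVar d (k + 2)

/-- At p(v) every row of the Hankel matrix is a multiple of (v₀², v₀v₁, v₁²). At p(a) + p(b) the
rows thus lie in a space spanned by two vectors, and three of them are dependent. -/
theorem hankelMinor_mem {d : ℕ} (hd : 1 ≤ d) {i j k : ℕ} (hi : i + 2 ≤ d) (hj : j + 2 ≤ d)
    (hk : k + 2 ≤ d) : hankelMinor d i j k ∈ ideal (secantVariety d) := by
  rw [mem_ideal_secantVariety_iff_eval hd]
  intro a b
  have key : ∀ (v : Fin 2 → ℂ) (n : ℕ), n + 2 ≤ d → ∃ s : ℂ,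
      coord (powerVec d v) n = s * v 0 ^ 2 ∧ coord (powerVec d v) (n + 1) = s * (v 0 * v 1) ∧
        coord (powerVec d v) (n + 2) = s * v 1 ^ 2 := by
    intro v n hn
    refine ⟨v 0 ^ (d - (n + 2)) * v 1 ^ n, ?_, ?_, ?_⟩
    · rw [coord_powerVec (by omega), show d - n = d - (n + 2) + 2 by omega]
      ring
    · rw [coord_powerVec (by omega), show d - (n + 1) = d - (n + 2) + 1 by omega]
      ring
    · rw [coord_powerVec (by omega)]
      ring
  obtain ⟨s₁, h1, h2, h3⟩ := key a i hi
  obtain ⟨s₂, h4, h5, h6⟩ := key a j hj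
  obtain ⟨s₃, h7, h8, h9⟩ := key a k hk
  obtain ⟨t₁, g1, g2, g3⟩ := key b i hi
  obtain ⟨t₂, g4, g5, g6⟩ := key b j hj
  obtain ⟨t₃, g7, g8, g9⟩ := key b k hk
  simp only [hankelMinor, hankelCross, Matrix.cons_val, map_add, map_sub, map_mul, eval_coordVar,
    coord_add, h1, h2, h3, h4, h5, h6, h7, h8, h9, g1, g2, g3, g4, g5, g6, g7, g8, g9]
  ring

/-- A vector whose Hankel matrix with three columns has rank at most one lies over the rational
normal curve. -/
theorem mem_rationalNormalCurve_of_hankelCross {d : ℕ} (hd : 3 ≤ d) {x : Fin (d + 1) → ℂ}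
    (hx : x ≠ 0)
    (h : ∀ i j, i + 2 ≤ d → j + 2 ≤ d → ∀ l, eval x (hankelCross d i j l) = 0) :
    Projectivization.mk ℂ x hx ∈ rationalNormalCurve d := by
  have hq0 : ∀ i j, i + 2 ≤ d → j + 2 ≤ d →
      coord x (i + 1) * coord x (j + 2) = coord x (i + 2) * coord x (j + 1) := by
    intro i j hi hj
    simpa [hankelCross, eval_coordVar, sub_eq_zero] using h i j hi hj 0
  have hq1 : ∀ i j, i + 2 ≤ d → j + 2 ≤ d →
      coord x (i + 2) * coord x j = coord x i * coord x (j + 2) := by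
    intro i j hi hj
    simpa [hankelCross, eval_coordVar, sub_eq_zero] using h i j hi hj 1
  have hq2 : ∀ i j, i + 2 ≤ d → j + 2 ≤ d →
      coord x i * coord x (j + 1) = coord x (i + 1) * coord x j := by
    intro i j hi hj
    simpa [hankelCross, eval_coordVar, sub_eq_zero] using h i j hi hj 2
  suffices hs : ∃ (a : ℂ) (v : Fin 2 → ℂ), ∀ n ≤ d, coord x n = a * (v 0 ^ (d - n) * v 1 ^ n) by
    obtain ⟨a, v, hav⟩ := hs
    have hxv : x = a • powerVec d v := by
      funext i
      rw [← coord_val x i, hav i (by omega)]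
      rfl
    have hv : v ≠ 0 := by
      rintro rfl
      rw [powerVec_zero_vec (by omega), smul_zero] at hxv
      exact hx hxv
    rw [mk_congr hxv hx (hxv ▸ hx), mk_smul _ (powerVec_ne_zero d hv)]
    exact mk_powerVec_mem d hv _
  -- If the first coordinate is zero, the minors kill all but the last one; otherwise the
  -- coordinates form a geometric progression.
  by_cases h0 : coord x 0 = 0
  · have hz : ∀ n, n < d → coord x n = 0 := by
      intro n
      induction n with
      | zero => exact fun _ => h0
      | succ n ih =>
        intro hn
        have h1 : coord x (n + 1) * coord x (n + 1) = 0 := by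
          rcases n with _ | n
          · rw [← hq2 0 1 (by omega) (by omega), h0, zero_mul]
          · rw [← hq0 n (n + 1) (by omega) (by omega), ih (by omega), zero_mul]
        exact mul_self_eq_zero.1 h1
    refine ⟨coord x d, ![0, 1], fun n hn => ?_⟩
    rcases hn.lt_or_eq with hn | rfl
    · have : d - n ≠ 0 := by omega
      simp [hz n hn, this]
    · simp
  · let t := coord x 1 / coord x 0
    have ht : coord x 0 * t = coord x 1 := mul_div_cancel₀ _ h0
    have hz : ∀ n, n < d → coord x n = coord x 0 * t ^ n := by
      intro n
      induction n with
      | zero => simp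
      | succ n ih =>
        intro hn
        refine mul_left_cancel₀ h0 ?_
        rw [hq2 0 n (by omega) (by omega), ih (by omega), zero_add, ← ht]
        ring
    refine ⟨coord x 0, ![1, t], fun n hn => ?_⟩
    rcases hn.lt_or_eq with hn | rfl
    · simp [hz n hn]
    -- The last coordinate is out of reach of the minors of columns 0 and 1, since the last row is d
    -- - 2; columns 0 and 2 supply it.
    · obtain ⟨m, rfl⟩ : ∃ m, n = m + 2 := ⟨n - 2, by omega⟩
      refine mul_left_cancel₀ h0 ?_
      rw [← hq1 0 m (by omega) (by omega), hz m (by omega), zero_add, hz 2 (by omega)]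
      simp
      ring

/-- The tangent vectors at a point off the curve satisfy a linear recurrence, whose characteristic
polynomial is the square of the equation of the secant. -/
theorem recurrence_of_mem_tangentAt {d : ℕ} (hd : 1 ≤ d) {x w : Fin (d + 1) → ℂ} (hx : x ≠ 0)
    (hX : Projectivization.mk ℂ x hx ∈ secantVariety d) (hw : w ∈ tangentAt (secantVariety d) x)
    {i j k : ℕ} (hi : i + 2 ≤ d) (hj : j + 2 ≤ d) (hk : k + 4 ≤ d) (q : Fin 3 → ℂ)
    (hq : q = polyMap (hankelCross d i j) x) :
    q 0 ^ 2 * coord w k + 2 * q 0 * q 1 * coord w (k + 1) +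
      (q 1 ^ 2 + 2 * q 0 * q 2) * coord w (k + 2) + 2 * q 1 * q 2 * coord w (k + 3) +
      q 2 ^ 2 * coord w (k + 4) = 0 := by
  have hrow : ∀ n, n + 2 ≤ d →
      q 0 * coord x n + q 1 * coord x (n + 1) + q 2 * coord x (n + 2) = 0 := by
    intro n hn
    have := (mk_mem_secantVariety_iff hx).1 hX _ (hankelMinor_mem hd hi hj hn)
    simpa [hankelMinor, eval_coordVar, hq] using this
  have hD : ∀ n, dirDeriv x w (hankelMinor d i j n) =
      dirDeriv x w (hankelCross d i j 0) * coord x n +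
      dirDeriv x w (hankelCross d i j 1) * coord x (n + 1) +
      dirDeriv x w (hankelCross d i j 2) * coord x (n + 2) +
      (q 0 * coord w n + q 1 * coord w (n + 1) + q 2 * coord w (n + 2)) := by
    intro n
    simp only [hankelMinor, dirDeriv_add, dirDeriv_mul, dirDeriv_coordVar, eval_coordVar, hq,
      polyMap_apply]
    ring
  -- The differentiated minors for the rows k, k + 1, k + 2 contain the unknown derivatives of `q`.
  -- Weighting them by q 0, q 1, q 2 removes these: by the Hankel symmetry their coefficients become
  -- products of `q` with rows of `x`, which vanish.
  have h0 := hw _ (hankelMinor_mem hd hi hj (show k + 2 ≤ d by omega))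
  have h1 := hw _ (hankelMinor_mem hd hi hj (show k + 1 + 2 ≤ d by omega))
  have h2 := hw _ (hankelMinor_mem hd hi hj (show k + 2 + 2 ≤ d by omega))
  rw [hD] at h0 h1 h2
  have r0 := hrow k (by omega)
  have r1 := hrow (k + 1) (by omega)
  have r2 := hrow (k + 2) (by omega)
  simp only [add_assoc, Nat.reduceAdd] at h0 h1 h2 r0 r1 r2 ⊢
  linear_combination q 0 * h0 + q 1 * h1 + q 2 * h2 - dirDeriv x w (hankelCross d i j 0) * r0 -
    dirDeriv x w (hankelCross d i j 1) * r1 - dirDeriv x w (hankelCross d i j 2) * r2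

/-- Solutions of a linear recurrence that starts `d - 3` times on `d + 1` coordinates form a
space of dimension at most four. -/
theorem finrank_le_four_of_recurrence {d : ℕ} (hd : 3 ≤ d) (T : Submodule ℂ (Fin (d + 1) → ℂ))
    (A : ℕ → ℂ) (m : ℕ) (hm : m ≤ 4) (hA : A m ≠ 0)
    (h : ∀ w ∈ T, ∀ k, k + 4 ≤ d → ∑ n ∈ Finset.range (m + 1), A n * coord w (k + n) = 0) :
    Module.finrank ℂ T ≤ 4 := by
  -- The recurrence determines the coordinates m, …, m + d - 4 from earlier ones. What remains free
  -- is the first `m` and the last `4 - m` coordinates.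
  let idx : Fin 4 → ℕ := fun i => if (i : ℕ) < m then i else i + (d - 3)
  let f : T →ₗ[ℂ] (Fin 4 → ℂ) :=
    { toFun := fun w i => coord w.1 (idx i)
      map_add' := fun w w' => by
        funext i
        exact coord_add _ _ _
      map_smul' := fun a w => by
        funext i
        exact coord_smul _ _ _ }
  have hf : Function.Injective f := by
    rw [← LinearMap.ker_eq_bot, LinearMap.ker_eq_bot']
    rintro ⟨w, hw⟩ hfw
    have hz : ∀ n, n ≤ d → coord w n = 0 := by
      intro n
      induction n using Nat.strong_induction_on with
      | _ n ih =>
        intro hn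
        by_cases h1 : n < m
        · have := congrFun hfw ⟨n, by omega⟩
          simpa [f, idx, h1] using this
        by_cases h2 : m + (d - 3) ≤ n
        · have := congrFun hfw ⟨n - (d - 3), by omega⟩
          have h3 : ¬ n - (d - 3) < m := by omega
          have h4 : n - (d - 3) + (d - 3) = n := by omega
          simpa [f, idx, h3, h4] using this
        · have h3 := h w hw (n - m) (by omega)
          rw [Finset.sum_range_succ, Finset.sum_eq_zero, zero_add, Nat.sub_add_cancel (by omega)]
            at h3
          · exact (mul_eq_zero.1 h3).resolve_left hA
          · intro l hl
            rw [Finset.mem_range] at hl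
            rw [ih _ (by omega) (by omega), mul_zero]
    refine Subtype.ext (funext fun i => ?_)
    change w i = 0
    rw [← coord_val w i]
    exact hz i (by omega)
  simpa using LinearMap.finrank_le_finrank_of_injective hf

theorem finrank_tangentAt_le {d : ℕ} (hd : 3 ≤ d) {x : Fin (d + 1) → ℂ} (hx : x ≠ 0)
    (hX : Projectivization.mk ℂ x hx ∈ secantVariety d)
    (hC : Projectivization.mk ℂ x hx ∉ rationalNormalCurve d) :
    Module.finrank ℂ (tangentAt (secantVariety d) x) ≤ 4 := by
  have hex : ∃ i j, i + 2 ≤ d ∧ j + 2 ≤ d ∧ polyMap (hankelCross d i j) x ≠ 0 := by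
    by_contra! hcon
    exact hC (mem_rationalNormalCurve_of_hankelCross hd hx fun i j hi hj l =>
      congrFun (hcon i j hi hj) l)
  obtain ⟨i, j, hi, hj, hne⟩ := hex
  obtain ⟨q, hq⟩ : ∃ q, q = polyMap (hankelCross d i j) x := ⟨_, rfl⟩
  rw [← hq] at hne
  have hrec := fun w hw k hk =>
    recurrence_of_mem_tangentAt (by omega) (w := w) (k := k) hx hX hw hi hj hk q hq
  -- If l is the largest index with `q l ≠ 0`, then q(T)² has degree 2l and leading coefficient `q l
  -- ^ 2`, whence the orders 4, 2 and 0.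
  by_cases h2 : q 2 = 0
  · by_cases h1 : q 1 = 0
    · have h0 : q 0 ≠ 0 := by
        intro h0
        refine hne (funext fun l => ?_)
        fin_cases l <;> assumption
      refine finrank_le_four_of_recurrence hd _ (fun _ => q 0 ^ 2) 0 (by norm_num) (pow_ne_zero _ h0)
        fun w hw k hk => ?_
      have := hrec w hw k hk
      simpa [h1, h2] using this
    · refine finrank_le_four_of_recurrence hd _
        (fun n => if n = 0 then q 0 ^ 2 else if n = 1 then 2 * q 0 * q 1 else q 1 ^ 2) 2
        (by norm_num) (by simpa using h1) fun w hw k hk => ?_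
      have := hrec w hw k hk
      simpa [h2, Finset.sum_range_succ] using this
  · refine finrank_le_four_of_recurrence hd _
      (fun n => if n = 0 then q 0 ^ 2 else if n = 1 then 2 * q 0 * q 1 else
        if n = 2 then q 1 ^ 2 + 2 * q 0 * q 2 else if n = 3 then 2 * q 1 * q 2 else q 2 ^ 2) 4
      le_rfl (by simpa using h2) fun w hw k hk => ?_
    have := hrec w hw k hk
    simpa [Finset.sum_range_succ] using this

/-- The singular locus of the secant variety is the rational normal curve. -/
theorem singularLocus_secantVariety {d : ℕ} (hd : 4 ≤ d) :
    singularLocus (secantVariety d) = rationalNormalCurve d := by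
  ext p
  induction p using Projectivization.ind with | _ x hx =>
  rw [singularLocus, Set.mem_ofPred_eq, trdeg_secantVariety (by omega), coneTangentSpace_mk]
  constructor
  · rintro ⟨hX, hlt⟩
    by_contra hC
    have h1 := finrank_tangentAt_le (by omega) hx hX hC
    have h2 : 4 < Module.finrank ℂ (tangentAt (secantVariety d) x) := by exact_mod_cast hlt
    omega
  · intro hC
    refine ⟨rationalNormalCurve_subset_secantVariety (by omega) hC, ?_⟩
    obtain ⟨v, a, hv, ha, rfl⟩ := exists_of_mk_mem_rationalNormalCurve hC
    rw [tangentAt_smul _ _ ha, tangentAt_powerVec (by omega), finrank_top, Module.finrank_fin_fun]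
    -- Here `d ≥ 4` is needed: for d = 3 the full space would have dimension 4 as well.
    exact_mod_cast (by omega : 4 < d + 1)

end ProjVar

/-! ### Restriction of automorphisms to the curve -/

namespace ProjVar

theorem aut_mem_rationalNormalCurve {d : ℕ} (hd : 4 ≤ d) (φ : Aut (secantVariety d))
    {x : secantVariety d} (hx : x.1 ∈ rationalNormalCurve d) :
    (φ.1 x).1 ∈ rationalNormalCurve d := by
  rw [← singularLocus_secantVariety hd] at hx ⊢
  exact mem_singularLocus_of_mem φ hx

/-- Restriction of the automorphisms of the secant variety to its singular locus, the curve. -/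
def restrictAut {d : ℕ} (hd : 4 ≤ d) : Aut (secantVariety d) →* Aut (rationalNormalCurve d) :=
  have hC : rationalNormalCurve d ⊆ secantVariety d :=
    rationalNormalCurve_subset_secantVariety (by omega)
  { toFun := fun φ =>
      ⟨{ toFun := fun x => ⟨(φ.1 ⟨x.1, hC x.2⟩).1,
          aut_mem_rationalNormalCurve hd φ (x := ⟨x.1, hC x.2⟩) x.2⟩
         invFun := fun x => ⟨(φ.1.symm ⟨x.1, hC x.2⟩).1,
          aut_mem_rationalNormalCurve hd φ⁻¹ (x := ⟨x.1, hC x.2⟩) x.2⟩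
         left_inv := fun x => by
          refine Subtype.ext ?_
          exact congrArg (fun y : secantVariety d => y.1) (φ.1.symm_apply_apply ⟨x.1, hC x.2⟩)
         right_inv := fun x => by
          refine Subtype.ext ?_
          exact congrArg (fun y : secantVariety d => y.1) (φ.1.apply_symm_apply ⟨x.1, hC x.2⟩) },
        φ.2.1.restrict hC fun _ => rfl, φ.2.2.restrict hC fun _ => rfl⟩
    map_one' := rfl
    map_mul' := fun _ _ => rfl }

theorem restrictAut_apply {d : ℕ} (hd : 4 ≤ d) (φ : Aut (secantVariety d)) (x : secantVariety d)
    (hx : x.1 ∈ rationalNormalCurve d) : ((restrictAut hd φ).1 ⟨x.1, hx⟩).1 = (φ.1 x).1 := rfl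

theorem restrictAut_injective {d : ℕ} (hd : 4 ≤ d) : Function.Injective (restrictAut hd) := by
  rw [injective_iff_map_eq_one]
  intro φ hφ
  refine Subtype.ext (Equiv.ext fun x => ?_)
  refine eq_self_of_fixes_curve (by omega) φ.2.1 (fun y hy => Subtype.ext ?_) x
  rw [← restrictAut_apply hd φ y hy, hφ]
  rfl

/-- An automorphism of the curve is transported to the line, where it is given by a matrix, and the
matrix acts on the secant variety. -/
theorem restrictAut_surjective {d : ℕ} (hd : 4 ≤ d) : Function.Surjective (restrictAut hd) := by
  intro θ
  have hd1 : 1 ≤ d := by omega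
  obtain ⟨ψ, rfl⟩ := (veroneseAut hd1).surjective θ
  obtain ⟨g, rfl⟩ := pglToAut_surjective ψ
  induction g using Matrix.ProjGenLinGroup.induction_on with | mk g =>
  obtain ⟨φ, hφ⟩ := exists_aut_secantVariety hd1 g
  refine ⟨φ, Subtype.ext (Equiv.ext fun x => Subtype.ext ?_)⟩
  obtain ⟨_, p, rfl⟩ := x
  have hp := rationalNormalCurve_subset_secantVariety hd1 ⟨p, rfl⟩
  refine Eq.trans ?_ (veroneseAut_apply hd1 _ ⟨p, trivial⟩).symm
  induction p using Projectivization.ind with | _ v hv =>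
  exact hφ v hv hp

end ProjVar

end

theorem proposition2p4 (d : ℕ) (hd : 4 ≤ d) :
    -- the singular locus of the secant variety is the rational normal curve
    ProjVar.singularLocus (ProjVar.secantVariety d) = ProjVar.rationalNormalCurve d ∧
    -- restriction to the curve is a well-defined isomorphism of automorphism groups
    (∃ γ : ProjVar.Aut (ProjVar.secantVariety d) ≃* ProjVar.Aut (ProjVar.rationalNormalCurve d),
      ∀ (φ : ProjVar.Aut (ProjVar.secantVariety d)) (x : ProjVar.secantVariety d)
        (hx : x.1 ∈ ProjVar.rationalNormalCurve d), ((γ φ).1 ⟨x.1, hx⟩).1 = (φ.1 x).1) ∧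
    -- the Veronese map identifies the automorphisms of the line with those of the curve
    (∃ ν : ProjVar.Aut ProjVar.projectiveLine ≃* ProjVar.Aut (ProjVar.rationalNormalCurve d),
      ∀ (ψ : ProjVar.Aut ProjVar.projectiveLine) (p : ProjVar.projectiveLine),
        ((ν ψ).1 ⟨ProjVar.veronese d p.1, Set.mem_range_self p.1⟩).1 =
          ProjVar.veronese d (ψ.1 p).1) ∧
    -- `PGL(2, ℂ)` is the automorphism group of the line through its usual action
    (∃ δ : Matrix.ProjGenLinGroup (Fin 2) ℂ ≃* ProjVar.Aut ProjVar.projectiveLine,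
      ∀ (g : Matrix.ProjGenLinGroup (Fin 2) ℂ) (p : ProjVar.projectiveLine),
        ((δ g).1 p).1 = g • p.1) :=
  ⟨ProjVar.singularLocus_secantVariety hd,
    ⟨MulEquiv.ofBijective (ProjVar.restrictAut hd)
      ⟨ProjVar.restrictAut_injective hd, ProjVar.restrictAut_surjective hd⟩,
      ProjVar.restrictAut_apply hd⟩,
    ⟨ProjVar.veroneseAut (by omega), ProjVar.veroneseAut_apply (by omega)⟩,
    ⟨ProjVar.pglEquivAut, ProjVar.pglToAut_apply⟩⟩
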